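/- Throughout, a \emph{signature} is a finite nonempty set $\sigma$ of relation symbols, each with an arity $\mathrm{ar}(R)\ge 1$. A \emph{structure} $\mathbb{A}$ in the signature $\sigma$ consists of a finite universe $A$ with $|A|\ge 2$ and, for each $R\in\sigma$, a relation $\emptyset\subsetneq R^{\mathbb{A}}\subsetneq A^{\mathrm{ar}(R)}$. A \emph{sentence} is a first-order sentence over $\sigma$ built from atomic formulas $R(x_1,\dots,x_{\mathrm{ar}(R)})$ using only $\exists,\forall,\wedge,\vee$ (no equality, no negation). A pair $(\mathbb{A},\mathbb{B})$ of structures in the same signature is a \emph{$\{\exists,\forall,\wedge,\vee\}$-PMC template} if every sentence true in $\mathbb{A}$ is true in $\mathbb{B}$. The promise problem $\mathrm{PMC}(\mathbb{A},\mathbb{B})$ has as inputs the sentences $\phi$ (encoded as words over a finite alphabet, with variable indices in binary); the Yes-instances are those with $\mathbb{A}\models\phi$ and the No-instances are those with $\mathbb{B}\not\models\phi$. Membership of a promise problem in a complexity class means that some machine obeys the resource bound of the class on every input sentence and answers correctly on all Yes-instances and all No-instances. A \emph{surjective multi-homomorphism} from $\mathbb{A}$ to $\mathbb{B}$ is a map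 $f$ assigning to each $a\in A$ a nonempty set $f(a)\subseteq B$ such that every $b\in B$ lies in some $f(a)$ and such that $f(a_1)\times\dots\times f(a_n)\subseteq R^{\mathbb{B}}$ whenever $R\in\sigma$ has arity $n$ and $(a_1,\dots,a_n)\in R^{\mathbb{A}}$. It is an \emph{A-shop} if $f(a^*)=B$ for some $a^*\in A$, and an \emph{E-shop} if there is $b^*\in B$ with $b^*\in f(a)$ for all $a\in A$. \textbf{Theorem.} Let $(\mathbb{A},\mathbb{B})$ be a $\{\exists,\forall,\wedge,\vee\}$-PMC template. \begin{enumerate} \item If there is an A-shop from $\mathbb{A}$ to $\mathbb{B}$, then $\mathrm{PMC}(\mathbb{A},\mathbb{B})$ is in $\mathrm{NP}$. \item If there is an E-shop from $\mathbb{A}$ to $\mathbb{B}$, then $\mathrm{PMC}(\mathbb{A},\mathbb{B})$ is in $\mathrm{coNP}$. \item If there is a surjective multi-homomorphism from $\mathbb{A}$ to $\mathbb{B}$ that is both an A-shop and an E-shop, then $\mathrm{PMC}(\mathbb{A},\mathbb{B})$ is in $\mathrm{L}$ (deterministic logarithmic space). Moreover, in this case there is a structure $\mathbb{C}$ in the same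 signature such that some surjective multi-homomorphism from $\mathbb{C}$ to $\mathbb{C}$ is both an A-shop and an E-shop, $(\mathbb{A},\mathbb{C})$ and $(\mathbb{C},\mathbb{B})$ are $\{\exists,\forall,\wedge,\vee\}$-PMC templates (that is, $(\mathbb{A},\mathbb{B})$ is a relaxation of $(\mathbb{C},\mathbb{C})$), and the non-promise problem $\mathrm{PMC}(\mathbb{C},\mathbb{C})$ is in $\mathrm{L}$. \end{enumerate} -/

import Mathlib

namespace PromiseMC

/-! ### Relational structures -/

/-- A finite nonempty relational signature; all arities are at least one. -/
structure Signature where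
  Sym : Type
  [finiteSym : Finite Sym]
  [nonemptySym : Nonempty Sym]
  arity : Sym → ℕ
  arity_pos : ∀ R, 1 ≤ arity R

attribute [instance] Signature.finiteSym Signature.nonemptySym

/-- A structure: a finite universe with at least two elements, and a nonempty proper relation for
each symbol of the signature. -/
structure RelStr (σ : Signature) where
  carrier : Type
  [finiteCarrier : Finite carrier]
  [nontrivialCarrier : Nontrivial carrier]
  rel : (R : σ.Sym) → Set (Fin (σ.arity R) → carrier)
  rel_nonempty : ∀ R, (rel R).Nonempty
  rel_proper : ∀ R, rel R ≠ Set.univ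

attribute [instance] RelStr.finiteCarrier RelStr.nontrivialCarrier

/-! ### Surjective multi-homomorphisms -/

/-- The inverse of a multi-valued function. -/
def mvInverse {α β : Type} (f : α → Set β) (b : β) : Set α := {a | b ∈ f a}

/-- `f` is a surjective multi-homomorphism from `A` to `B`. -/
structure IsSMuHom {σ : Signature} (A B : RelStr σ) (f : A.carrier → Set B.carrier) : Prop where
  value_nonempty : ∀ a, (f a).Nonempty
  surjective : ∀ b, ∃ a, b ∈ f a
  map_rel : ∀ (R : σ.Sym), ∀ a ∈ A.rel R, ∀ b : Fin (σ.arity R) → B.carrier,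
    (∀ i, b i ∈ f (a i)) → b ∈ B.rel R

/-- A surjective multi-homomorphism with `f(a*) = B` for some `a*`. -/
def IsAShop {σ : Signature} (A B : RelStr σ) (f : A.carrier → Set B.carrier) : Prop :=
  IsSMuHom A B f ∧ ∃ a, f a = Set.univ

/-- A surjective multi-homomorphism with `f⁻¹(b*) = A` for some `b*`. -/
def IsEShop {σ : Signature} (A B : RelStr σ) (f : A.carrier → Set B.carrier) : Prop :=
  IsSMuHom A B f ∧ ∃ b, mvInverse f b = Set.univ

/-- A surjective multi-homomorphism of both kinds simultaneously. -/
def IsEAShop {σ : Signature} (A B : RelStr σ) (f : A.carrier → Set B.carrier) : Prop :=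
  IsAShop A B f ∧ IsEShop A B f

/-! ### The fragment with `∃`, `∀`, `∧`, `∨` of first-order logic -/

/-- Formulas over the signature `σ`; the variables are named by natural numbers. -/
inductive Fml (σ : Signature) : Type
  | atom (R : σ.Sym) (v : Fin (σ.arity R) → ℕ) : Fml σ
  | and (φ ψ : Fml σ) : Fml σ
  | or (φ ψ : Fml σ) : Fml σ
  | ex (x : ℕ) (φ : Fml σ) : Fml σ
  | all (x : ℕ) (φ : Fml σ) : Fml σ

namespace Fml

variable {σ : Signature}

def freeVars : Fml σ → Set ℕ
  | atom _ v => Set.range v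
  | and φ ψ => φ.freeVars ∪ ψ.freeVars
  | or φ ψ => φ.freeVars ∪ ψ.freeVars
  | ex x φ => φ.freeVars \ {x}
  | all x φ => φ.freeVars \ {x}

/-- Satisfaction of a formula in `A` under the evaluation `s` of the variables. -/
def Sat (A : RelStr σ) : (ℕ → A.carrier) → Fml σ → Prop
  | s, atom R v => (fun i => s (v i)) ∈ A.rel R
  | s, and φ ψ => Sat A s φ ∧ Sat A s ψ
  | s, or φ ψ => Sat A s φ ∨ Sat A s ψ
  | s, ex x φ => ∃ a, Sat A (Function.update s x a) φ
  | s, all x φ => ∀ a, Sat A (Function.update s x a) φ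

end Fml

/-- A sentence is a formula without free variables. -/
def Sentence (σ : Signature) : Type := {φ : Fml σ // φ.freeVars = ∅}

/-- `A ⊨ φ`. The truth of a sentence does not depend on the evaluation of the variables. -/
def Models {σ : Signature} (A : RelStr σ) (φ : Sentence σ) : Prop :=
  ∀ s : ℕ → A.carrier, φ.1.Sat A s

/-- `(A, B)` is a template: every sentence true in `A` is true in `B`. -/
def IsTemplate {σ : Signature} (A B : RelStr σ) : Prop :=
  ∀ φ : Sentence σ, Models A φ → Models B φ

/-- The template `(C, D)` is a relaxation of the template `(A, B)`. -/
def IsRelaxation {σ : Signature} (C D A B : RelStr σ) : Prop :=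
  IsTemplate C A ∧ IsTemplate B D

/-! ### Sentences as words over a finite alphabet -/

inductive Token (σ : Signature) : Type
  | lparen : Token σ
  | rparen : Token σ
  | and : Token σ
  | or : Token σ
  | ex : Token σ
  | all : Token σ
  | comma : Token σ
  | bit (b : Bool) : Token σ
  | rel (R : σ.Sym) : Token σ

instance Token.finite (σ : Signature) : Finite (Token σ) := by
  let g : Fin 7 ⊕ Bool ⊕ σ.Sym → Token σ := fun
    | .inl i => ![.lparen, .rparen, .and, .or, .ex, .all, .comma] i
    | .inr (.inl b) => .bit b
    | .inr (.inr R) => .rel R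
  refine Finite.of_surjective g ?_
  intro t
  cases t with
  | lparen => exact ⟨.inl 0, rfl⟩
  | rparen => exact ⟨.inl 1, rfl⟩
  | and => exact ⟨.inl 2, rfl⟩
  | or => exact ⟨.inl 3, rfl⟩
  | ex => exact ⟨.inl 4, rfl⟩
  | all => exact ⟨.inl 5, rfl⟩
  | comma => exact ⟨.inl 6, rfl⟩
  | bit b => exact ⟨.inr (.inl b), rfl⟩
  | rel R => exact ⟨.inr (.inr R), rfl⟩

/-- A variable is written as its index in binary (least significant bit first), ended by a
comma. -/
def encodeVar (σ : Signature) (x : ℕ) : List (Token σ) :=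
  x.bits.map Token.bit ++ [Token.comma]

/-- Formulas are written in fully parenthesized infix notation: `R x,y,…,`, `(φ∧ψ)`, `(φ∨ψ)`,
`∃x,φ` and `∀x,φ`. -/
def Fml.encode {σ : Signature} : Fml σ → List (Token σ)
  | atom R v => Token.rel R :: (List.ofFn v).flatMap (encodeVar σ)
  | and φ ψ => Token.lparen :: (φ.encode ++ Token.and :: (ψ.encode ++ [Token.rparen]))
  | or φ ψ => Token.lparen :: (φ.encode ++ Token.or :: (ψ.encode ++ [Token.rparen]))
  | ex x φ => Token.ex :: (encodeVar σ x ++ φ.encode)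
  | all x φ => Token.all :: (encodeVar σ x ++ φ.encode)

theorem encodeVar_cancel {σ : Signature} {x y : ℕ} {r s : List (Token σ)}
    (h : encodeVar σ x ++ r = encodeVar σ y ++ s) : x = y ∧ r = s := by
  have key : ∀ (l m : List Bool), l.map Token.bit ++ [Token.comma] ++ r =
      m.map Token.bit ++ [Token.comma] ++ s → l = m ∧ r = s := by
    intro l
    induction l with
    | nil => intro m hm; cases m <;> simp_all
    | cons b l ih =>
      intro m hm
      cases m with
      | nil => simp_all
      | cons c m =>
        simp only [List.map_cons, List.cons_append, List.cons.injEq, Token.bit.injEq] at hm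
        obtain ⟨h1, h2⟩ := ih m hm.2
        exact ⟨by rw [hm.1, h1], h2⟩
  obtain ⟨h1, h2⟩ := key _ _ h
  refine ⟨?_, h2⟩
  apply Nat.eq_of_testBit_eq
  intro i
  rw [Nat.testBit_eq_inth, Nat.testBit_eq_inth, h1]

theorem Fml.encode_cancel {σ : Signature} (φ : Fml σ) :
    ∀ (ψ : Fml σ) (r s : List (Token σ)), φ.encode ++ r = ψ.encode ++ s → φ = ψ ∧ r = s := by
  induction φ with
  | atom R v =>
    intro ψ r s h
    cases ψ with
    | atom R' v' =>
      simp only [encode, List.cons_append, List.cons.injEq, Token.rel.injEq] at h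
      obtain ⟨rfl, h⟩ := h
      have key : ∀ l m : List ℕ, l.length = m.length →
          l.flatMap (encodeVar σ) ++ r = m.flatMap (encodeVar σ) ++ s → l = m ∧ r = s := by
        intro l
        induction l with
        | nil => intro m hm he; cases m <;> simp_all
        | cons a l ih =>
          intro m hm he
          cases m with
          | nil => simp at hm
          | cons b m =>
            simp only [List.flatMap_cons, List.append_assoc] at he
            obtain ⟨rfl, h2⟩ := encodeVar_cancel he
            obtain ⟨rfl, h3⟩ := ih m (by simpa using hm) h2
            exact ⟨rfl, h3⟩
      obtain ⟨h1, h2⟩ := key _ _ (by simp) h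
      rw [List.ofFn_injective h1]
      exact ⟨rfl, h2⟩
    | _ => simp [encode] at h
  | and φ₁ φ₂ ih₁ ih₂ =>
    intro ψ r s h
    cases ψ with
    | and ψ₁ ψ₂ =>
      simp only [encode, List.cons_append, List.append_assoc, List.cons.injEq, true_and] at h
      obtain ⟨rfl, h2⟩ := ih₁ _ _ _ h
      simp only [List.cons.injEq, true_and] at h2
      obtain ⟨rfl, h3⟩ := ih₂ _ _ _ h2
      simpa using h3
    | or ψ₁ ψ₂ =>
      simp only [encode, List.cons_append, List.append_assoc, List.cons.injEq, true_and] at h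
      have h2 := (ih₁ _ _ _ h).2
      simp at h2
    | _ => simp [encode] at h
  | or φ₁ φ₂ ih₁ ih₂ =>
    intro ψ r s h
    cases ψ with
    | or ψ₁ ψ₂ =>
      simp only [encode, List.cons_append, List.append_assoc, List.cons.injEq, true_and] at h
      obtain ⟨rfl, h2⟩ := ih₁ _ _ _ h
      simp only [List.cons.injEq, true_and] at h2
      obtain ⟨rfl, h3⟩ := ih₂ _ _ _ h2
      simpa using h3
    | and ψ₁ ψ₂ =>
      simp only [encode, List.cons_append, List.append_assoc, List.cons.injEq, true_and] at h
      have h2 := (ih₁ _ _ _ h).2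
      simp at h2
    | _ => simp [encode] at h
  | ex x φ ih =>
    intro ψ r s h
    cases ψ with
    | ex y ψ =>
      simp only [encode, List.cons_append, List.append_assoc, List.cons.injEq, true_and] at h
      obtain ⟨rfl, h2⟩ := encodeVar_cancel h
      obtain ⟨rfl, h3⟩ := ih _ _ _ h2
      exact ⟨rfl, h3⟩
    | _ => simp [encode] at h
  | all x φ ih =>
    intro ψ r s h
    cases ψ with
    | all y ψ =>
      simp only [encode, List.cons_append, List.append_assoc, List.cons.injEq, true_and] at h
      obtain ⟨rfl, h2⟩ := encodeVar_cancel h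
      obtain ⟨rfl, h3⟩ := ih _ _ _ h2
      exact ⟨rfl, h3⟩
    | _ => simp [encode] at h

/-! ### Turing machines -/

inductive Move : Type
  | left : Move
  | stay : Move
  | right : Move

/-- Symbols on the input tape: an input word is written between two end markers. -/
inductive InSym (Γ : Type) : Type
  | leftEnd : InSym Γ
  | sym (g : Γ) : InSym Γ
  | rightEnd : InSym Γ

/-- What a machine with states `Q`, work alphabet `S` and `k` work tapes does in one step. -/
structure Action (Q S : Type) (k : ℕ) where
  next : Q
  inMove : Move
  write : Fin k → S
  move : Fin k → Move

/-- A nondeterministic Turing machine with input alphabet `Γ`, a read-only two-way input tape and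
`k` work tapes, each infinite to the right. It halts when no action is available. -/
structure TM (Γ : Type) where
  Q : Type
  [finiteQ : Finite Q]
  S : Type
  [finiteS : Finite S]
  k : ℕ
  blank : S
  start : Q
  accepting : Set Q
  δ : Q → InSym Γ → (Fin k → S) → Set (Action Q S k)

attribute [instance] TM.finiteQ TM.finiteS

/-- The symbol in cell `p` of the input tape: cell `0` holds the left end marker, cells
`1, …, |x|` hold the input word `x`, and cell `|x| + 1` the right end marker. -/
def readInput {Γ : Type} (x : List Γ) : ℕ → InSym Γ
  | 0 => .leftEnd
  | p + 1 => match x[p]? with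
    | some g => .sym g
    | none => .rightEnd

/-- The head on a work tape does not move when it is told to leave cell `0` to the left. -/
def Move.work : Move → ℕ → ℕ
  | left, p => p - 1
  | stay, p => p
  | right, p => p + 1

/-- The head on the input tape stays between the end markers; `n` is the length of the input. -/
def Move.input (n : ℕ) : Move → ℕ → ℕ
  | left, p => p - 1
  | stay, p => p
  | right, p => min (p + 1) (n + 1)

namespace TM

variable {Γ : Type}

structure Cfg (M : TM Γ) where
  state : M.Q
  inHead : ℕ
  tape : Fin M.k → ℕ → M.S
  head : Fin M.k → ℕ

def initCfg (M : TM Γ) : M.Cfg where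
  state := M.start
  inHead := 0
  tape := fun _ _ => M.blank
  head := fun _ => 0

/-- The actions available in a configuration. -/
def actions (M : TM Γ) (x : List Γ) (c : M.Cfg) : Set (Action M.Q M.S M.k) :=
  M.δ c.state (readInput x c.inHead) (fun j => c.tape j (c.head j))

def applyAction (M : TM Γ) (x : List Γ) (c : M.Cfg) (a : Action M.Q M.S M.k) : M.Cfg where
  state := a.next
  inHead := a.inMove.input x.length c.inHead
  tape := fun j => Function.update (c.tape j) (c.head j) (a.write j)
  head := fun j => (a.move j).work (c.head j)

def Step (M : TM Γ) (x : List Γ) (c c' : M.Cfg) : Prop :=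
  ∃ a ∈ M.actions x c, c' = M.applyAction x c a

/-- Some computation on input `x` is in configuration `c` after exactly `t` steps. -/
def ReachesIn (M : TM Γ) (x : List Γ) : ℕ → M.Cfg → Prop
  | 0, c => c = M.initCfg
  | t + 1, c => ∃ c', M.ReachesIn x t c' ∧ M.Step x c' c

def Halted (M : TM Γ) (x : List Γ) (c : M.Cfg) : Prop := M.actions x c = ∅

/-- Some computation on input `x` halts. -/
def Halts (M : TM Γ) (x : List Γ) : Prop := ∃ t c, M.ReachesIn x t c ∧ M.Halted x c

/-- Some computation on input `x` halts in an accepting state. -/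
def Accepts (M : TM Γ) (x : List Γ) : Prop :=
  ∃ t c, M.ReachesIn x t c ∧ M.Halted x c ∧ c.state ∈ M.accepting

/-- Every computation on input `x` has at most `T` steps. -/
def RunsInTime (M : TM Γ) (x : List Γ) (T : ℕ) : Prop := ∀ t c, M.ReachesIn x t c → t ≤ T

/-- On input `x` at most the first `s` cells of each work tape are ever visited. -/
def RunsInSpace (M : TM Γ) (x : List Γ) (s : ℕ) : Prop :=
  ∀ t c, M.ReachesIn x t c → ∀ j, c.head j < s

def Deterministic (M : TM Γ) : Prop := ∀ q i w, (M.δ q i w).Subsingleton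

end TM

/-! ### Promise problems and complexity classes -/

/-- A promise problem: instances, written as words over a finite alphabet, with disjoint sets of
yes-instances and no-instances. -/
structure PromiseProblem where
  Inst : Type
  Alphabet : Type
  [finiteAlphabet : Finite Alphabet]
  encode : Inst → List Alphabet
  encode_injective : Function.Injective encode
  yes : Set Inst
  no : Set Inst
  yes_no_disjoint : Disjoint yes no

namespace PromiseProblem

/-- The problem with yes-instances and no-instances exchanged. -/
def swap (P : PromiseProblem) : PromiseProblem where
  Inst := P.Inst
  Alphabet := P.Alphabet
  finiteAlphabet := P.finiteAlphabet
  encode := P.encode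
  encode_injective := P.encode_injective
  yes := P.no
  no := P.yes
  yes_no_disjoint := P.yes_no_disjoint.symm

/-- Solvable in polynomial time by a nondeterministic Turing machine. The time bound holds for all
instances, whether or not they satisfy the promise. -/
def InNP (P : PromiseProblem) : Prop :=
  ∃ (M : TM P.Alphabet) (p : Polynomial ℕ),
    (∀ i, M.RunsInTime (P.encode i) (p.eval (P.encode i).length)) ∧
    (∀ i ∈ P.yes, M.Accepts (P.encode i)) ∧
    (∀ i ∈ P.no, ¬ M.Accepts (P.encode i))

def InCoNP (P : PromiseProblem) : Prop := P.swap.InNP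

/-- Solvable in logarithmic space by a deterministic Turing machine. Halting and the space bound
are required for all instances, whether or not they satisfy the promise. -/
def InL (P : PromiseProblem) : Prop :=
  ∃ (M : TM P.Alphabet) (c : ℕ), M.Deterministic ∧
    (∀ i, M.Halts (P.encode i)) ∧
    (∀ i, M.RunsInSpace (P.encode i) (c * (Nat.log 2 (P.encode i).length + 1))) ∧
    (∀ i ∈ P.yes, M.Accepts (P.encode i)) ∧
    (∀ i ∈ P.no, ¬ M.Accepts (P.encode i))

end PromiseProblem

/-- The promise model checking problem over the template `(A, B)`: distinguish the sentences true
in `A` from those not true in `B`. -/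
def PMC {σ : Signature} (A B : RelStr σ) (h : IsTemplate A B) : PromiseProblem where
  Inst := Sentence σ
  Alphabet := Token σ
  encode := fun φ => φ.1.encode
  encode_injective := fun φ ψ e =>
    Subtype.ext (Fml.encode_cancel φ.1 ψ.1 [] [] (by simpa using e)).1
  yes := {φ | Models A φ}
  no := {φ | ¬ Models B φ}
  yes_no_disjoint := Set.disjoint_left.2 fun φ hA hB => hB (h φ hA)

/-- The (non-promise) model checking problem over `C`. -/
def MC {σ : Signature} (C : RelStr σ) : PromiseProblem := PMC C C fun _ h => h

end PromiseMC

/-!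
If `f a = B`, then universal quantifiers may always play `a`: existential witnesses in `A` that beat
this strategy are turned by `f` into a proof that the sentence holds in `B`. So it suffices to guess
one witness per existential quantifier, which is an annotation of the input word, and to evaluate
the sentence once along the annotation. For E-shops, the inverse of `f` is an A-shop from the
complement of `B` to the complement of `A`, and the dual sentence is the letterwise image of the
given one. With an EA-shop on `C`, existential quantifiers may play a fixed element as well, so
nothing has to be guessed; and an EA-shop from `A` to `B` factors through a structure on two
elements.

The evaluation runs from left to right. It stores no assignment: whenever a variable occurs, the
quantifier that binds it is searched for to the left and its index is compared bit by bit. This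
takes finitely many states and three counters bounded by the length of the input, that is,
logarithmic space once the counters are kept in binary; a computation that halts within these
bounds never repeats a configuration, so it also takes polynomial time.
-/

namespace PromiseMC

open Relation

/-! ### Deterministic computations -/

theorem of_maximal_run {α : Type*} {r : α → α → Prop} {P : α → Prop}
    (hr : Relator.RightUnique r) {a b c : α}
    (hab : ReflTransGen (fun u v => r u v ∧ P v) a b) (ha : P a) (hb : ∀ d, ¬ r b d)
    (hac : ReflTransGen r a c) : P c ∧ ReflTransGen r c b := by
  induction hab using ReflTransGen.head_induction_on with
  | refl =>
    rcases hac.cases_head with rfl | ⟨d, hd, -⟩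
    · exact ⟨ha, .refl⟩
    · exact absurd hd (hb d)
  | head huv hvb ih =>
    rcases hac.cases_head with rfl | ⟨d, hd, hdc⟩
    · exact ⟨ha, .head huv.1 (ReflTransGen.mono (fun _ _ h => h.1) _ _ hvb)⟩
    · obtain rfl := hr huv.1 hd
      exact ih huv.2 hdc

namespace TM

variable {Γ : Type} {M : TM Γ} {x : List Γ}

theorem exists_reachesIn_iff {c : M.Cfg} :
    (∃ t, M.ReachesIn x t c) ↔ ReflTransGen (M.Step x) M.initCfg c := by
  constructor
  · rintro ⟨t, h⟩
    induction t generalizing c with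
    | zero => rw [show c = M.initCfg from h]
    | succ t ih =>
      obtain ⟨c', h', hs⟩ := h
      exact (ih h').tail hs
  · intro h
    induction h with
    | refl => exact ⟨0, rfl⟩
    | tail _ hs ih =>
      obtain ⟨t, ht⟩ := ih
      exact ⟨t + 1, _, ht, hs⟩

theorem Halted.not_step {c : M.Cfg} (hc : M.Halted x c) (d : M.Cfg) : ¬ M.Step x c d := by
  rintro ⟨a, ha, -⟩
  exact (Set.eq_empty_iff_forall_notMem.1 hc) a ha

theorem Deterministic.rightUnique_step (hM : M.Deterministic) :
    Relator.RightUnique (M.Step x) := by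
  rintro a _ _ ⟨u, hu, rfl⟩ ⟨v, hv, rfl⟩
  rw [hM _ _ _ hu hv]

/-- A step after which all work heads are in the cells `0, …, B`. -/
def SpaceStep (M : TM Γ) (x : List Γ) (B : ℕ) (c c' : M.Cfg) : Prop :=
  M.Step x c c' ∧ ∀ j, c'.head j ≤ B

variable {B : ℕ} {e : M.Cfg}

theorem Halted.halts (he : M.Halted x e) (h : ReflTransGen (M.SpaceStep x B) M.initCfg e) :
    M.Halts x := by
  obtain ⟨t, ht⟩ := exists_reachesIn_iff.2 (ReflTransGen.mono (fun _ _ h => h.1) _ _ h)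
  exact ⟨t, e, ht, he⟩

theorem Deterministic.runsInSpace (hM : M.Deterministic) (he : M.Halted x e)
    (h : ReflTransGen (M.SpaceStep x B) M.initCfg e) : M.RunsInSpace x (B + 1) :=
  fun t _ hc j => Nat.lt_succ_of_le <|
    (of_maximal_run hM.rightUnique_step h (fun _ => Nat.zero_le _) he.not_step
      (exists_reachesIn_iff.1 ⟨t, hc⟩)).1 j

theorem Deterministic.accepts_iff (hM : M.Deterministic) (he : M.Halted x e)
    (h : ReflTransGen (M.SpaceStep x B) M.initCfg e) : M.Accepts x ↔ e.state ∈ M.accepting := by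
  constructor
  · rintro ⟨t, c, hc, hch, ha⟩
    have hce := (of_maximal_run hM.rightUnique_step h (fun _ => Nat.zero_le _) he.not_step
      (exists_reachesIn_iff.1 ⟨t, hc⟩)).2
    rcases hce.cases_head with rfl | ⟨d, hd, -⟩
    · exact ha
    · exact absurd hd (hch.not_step d)
  · intro ha
    obtain ⟨t, ht⟩ := exists_reachesIn_iff.2 (ReflTransGen.mono (fun _ _ h => h.1) _ _ h)
    exact ⟨t, e, ht, he, ha⟩

end TM

/-! ### Counter automata -/

/-- A deterministic automaton with a two-way read-only input tape and `m` counters, which can be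
incremented, decremented and tested for zero. It is the common intermediate model from which both
the nondeterministic and the logarithmic space Turing machines are compiled. -/
structure CounterAutomaton (Γ : Type) where
  Q : Type
  [finiteQ : Finite Q]
  m : ℕ
  start : Q
  δ : Q → InSym Γ → (Fin m → Bool) → Option (Q × Move × (Fin m → Move))

attribute [instance] CounterAutomaton.finiteQ

namespace CounterAutomaton

variable {Γ : Type}

/-- A configuration of a counter automaton. As for Turing machines, input cell `0` holds the left
end marker. -/
@[ext]
structure Cfg (M : CounterAutomaton Γ) where
  state : M.Q
  pos : ℕ
  ctr : Fin M.m → ℕ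

/-- The initial configuration, with all counters `0`. -/
def initCfg (M : CounterAutomaton Γ) : M.Cfg := ⟨M.start, 0, fun _ => 0⟩

/-- The instruction to be executed in a configuration. -/
def instr (M : CounterAutomaton Γ) (x : List Γ) (c : M.Cfg) :
    Option (M.Q × Move × (Fin M.m → Move)) :=
  M.δ c.state (readInput x c.pos) (fun j => decide (c.ctr j = 0))

/-- The configuration after the instruction `r`. A counter at `0` is not changed by a decrement. -/
def exec (M : CounterAutomaton Γ) (x : List Γ) (c : M.Cfg) (r : M.Q × Move × (Fin M.m → Move)) :
    M.Cfg :=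
  ⟨r.1, r.2.1.input x.length c.pos, fun j => (r.2.2 j).work (c.ctr j)⟩

/-- The next configuration; `none` if the automaton has halted. -/
def step (M : CounterAutomaton Γ) (x : List Γ) (c : M.Cfg) : Option M.Cfg :=
  (M.instr x c).map (M.exec x c)

/-- A step after which no counter exceeds the length of the input plus one. -/
def BStep (M : CounterAutomaton Γ) (x : List Γ) (c c' : M.Cfg) : Prop :=
  M.step x c = some c' ∧ ∀ j, c'.ctr j ≤ x.length + 1

/-- The automaton halts in state `q`, and no counter ever exceeds the length of the input plus
one. -/
def HaltsIn (M : CounterAutomaton Γ) (x : List Γ) (q : M.Q) : Prop :=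
  ∃ c, ReflTransGen (M.BStep x) M.initCfg c ∧ M.step x c = none ∧ c.state = q

end CounterAutomaton

/-! ### Binary counters on a work tape -/

/-- Tape symbols of a binary counter: cell `0` holds the mark, the following cells the bits,
least significant bit first. -/
inductive CtrSym : Type
  | blank : CtrSym
  | mark : CtrSym
  | bit (b : Bool) : CtrSym
  deriving Fintype

/-- The phases of the head on the tape of a binary counter. An idle counter knows whether its value
is zero; an update moves right through the bits it changes, goes on to the end of the counter, and
recomputes on the way back whether the new value is zero. -/
inductive CtrPhase : Type
  | blankTape : CtrPhase
  | idle (z : Bool) : CtrPhase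
  | inc : CtrPhase
  | dec : CtrPhase
  | toEnd : CtrPhase
  | back (z : Bool) : CtrPhase
  deriving Fintype

namespace CtrPhase

/-- The transition function of a counter tape. -/
def act : CtrPhase → CtrSym → CtrPhase × CtrSym × Move
  | blankTape, _ => (idle true, .mark, .stay)
  | idle z, s => (idle z, s, .stay)
  | inc, .bit true => (inc, .bit false, .right)
  | inc, .mark => (inc, .mark, .right)
  | inc, _ => (toEnd, .bit true, .right)
  | dec, .bit false => (dec, .bit true, .right)
  | dec, .bit true => (toEnd, .bit false, .right)
  | dec, .mark => (dec, .mark, .right)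
  | dec, .blank => (toEnd, .blank, .stay)
  | toEnd, .blank => (back true, .blank, .left)
  | toEnd, s => (toEnd, s, .right)
  | back z, .mark => (idle z, .mark, .stay)
  | back _, .bit true => (back false, .bit true, .left)
  | back z, s => (back z, s, .left)

/-- The counter is ready for the next operation. -/
def IsIdle : CtrPhase → Prop
  | idle _ => True
  | _ => False

/-- The zero test; it is meaningful only for an idle counter. -/
def isZero : CtrPhase → Bool
  | idle z => z
  | _ => false

/-- The phase in which an idle counter starts to execute a counter operation. -/
def begin (p : CtrPhase) : Move → CtrPhase
  | .right => inc
  | .left => if p.isZero then p else dec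
  | .stay => p

end CtrPhase

/-- The value of a list of bits, least significant bit first. -/
def bitsValue : List Bool → ℕ
  | [] => 0
  | b :: l => b.toNat + 2 * bitsValue l

/-- Increments a number in binary, lengthening it by one bit if all bits are `true`. -/
def incBits : List Bool → List Bool
  | [] => [true]
  | false :: l => true :: l
  | true :: l => false :: incBits l

/-- Decrements a positive number in binary, keeping its length; `0` in `n` bits becomes
`2 ^ n - 1`. -/
def decBits : List Bool → List Bool
  | [] => []
  | true :: l => false :: l
  | false :: l => true :: decBits l

theorem bitsValue_incBits (l : List Bool) : bitsValue (incBits l) = bitsValue l + 1 := by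
  fun_induction incBits l <;> simp_all [bitsValue] <;> omega

theorem length_incBits (l : List Bool) :
    (incBits l).length = l.length ∨
      (incBits l).length = l.length + 1 ∧ 2 ^ l.length = bitsValue l + 1 := by
  fun_induction incBits l with
  | case1 => simp [bitsValue]
  | case2 l => simp
  | case3 l ih =>
    refine ih.imp (by simp) fun h => ⟨by simp [h.1], ?_⟩
    simp only [List.length_cons, pow_succ, h.2, bitsValue, Bool.toNat_true]
    omega

theorem length_decBits (l : List Bool) : (decBits l).length = l.length := by
  fun_induction decBits l <;> simp_all

theorem bitsValue_decBits {l : List Bool} (hl : bitsValue l ≠ 0) :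
    bitsValue (decBits l) = bitsValue l - 1 := by
  fun_induction decBits l <;> simp_all [bitsValue]
  omega

theorem length_incBits_le_log {N : ℕ} {l : List Bool} (hl : l.length ≤ Nat.log 2 N + 1)
    (hN : bitsValue l + 1 ≤ N) : (incBits l).length ≤ Nat.log 2 N + 1 := by
  rcases length_incBits l with h | ⟨h, h'⟩
  · omega
  · have := Nat.le_log_of_pow_le one_lt_two (h'.trans_le hN)
    omega

/-- A configuration of a single counter tape. -/
@[ext]
structure CtrCfg where
  phase : CtrPhase
  tape : ℕ → CtrSym
  head : ℕ

namespace CtrCfg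

/-- A step of the counter tape on its own. -/
def step (c : CtrCfg) : CtrCfg :=
  let a := c.phase.act (c.tape c.head)
  ⟨a.1, Function.update c.tape c.head a.2.1, a.2.2.work c.head⟩

theorem step_of_isIdle {c : CtrCfg} (h : c.phase.IsIdle) : c.step = c := by
  obtain ⟨ph, tp, hd⟩ := c
  cases ph <;> simp_all [CtrPhase.IsIdle, step, CtrPhase.act, Move.work]

/-- The tape with content `l`, followed by blanks. -/
def tapeOf (l : List CtrSym) (p : ℕ) : CtrSym := l.getD p .blank

theorem update_tapeOf (a : List CtrSym) (b b' : CtrSym) (c : List CtrSym) :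
    Function.update (tapeOf (a ++ b :: c)) a.length b' = tapeOf (a ++ b' :: c) := by
  funext p
  rcases lt_trichotomy p a.length with h | rfl | h
  · rw [Function.update_of_ne h.ne]
    simp [tapeOf, List.getElem?_append_left h]
  · simp [tapeOf]
  · rw [Function.update_of_ne h.ne']
    obtain ⟨k, rfl⟩ := Nat.exists_eq_add_of_lt h
    simp [tapeOf, List.getElem?_append_right, Nat.add_assoc]

theorem tapeOf_append_blank (a : List CtrSym) : tapeOf (a ++ [.blank]) = tapeOf a := by
  funext p
  simp only [tapeOf, List.getD_eq_getElem?_getD, List.getElem?_append]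
  split_ifs with h
  · rfl
  · rw [List.getElem?_eq_none (not_lt.1 h), List.getElem?_singleton]
    split_ifs <;> rfl

/-- The configuration with `a` to the left of the head and `c` from the head on. -/
def zip (ph : CtrPhase) (a c : List CtrSym) : CtrCfg := ⟨ph, tapeOf (a ++ c), a.length⟩

theorem zip_nil (ph : CtrPhase) (a : List CtrSym) : zip ph a [] = zip ph a [.blank] := by
  simp [zip, tapeOf_append_blank]

theorem step_zip {ph ph' : CtrPhase} {b b' : CtrSym} {mv : Move} (h : ph.act b = (ph', b', mv))
    (a c : List CtrSym) :
    (zip ph a (b :: c)).step = ⟨ph', tapeOf (a ++ b' :: c), mv.work a.length⟩ := by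
  have hb : tapeOf (a ++ b :: c) a.length = b := by simp [tapeOf]
  simp [step, zip, hb, h, update_tapeOf]

/-- Runs on which the head stays in the cells `0, …, B`. -/
def Run (B : ℕ) : CtrCfg → CtrCfg → Prop :=
  ReflTransGen fun c c' => c' = c.step ∧ c'.head ≤ B

/-- The counter with bits `l` to the left and `r` to the right of the head. -/
def ofBits (ph : CtrPhase) (l r : List Bool) : CtrCfg :=
  zip ph (.mark :: l.map .bit) (r.map .bit)

/-- The idle counter with bits `l`. -/
def idleOf (l : List Bool) : CtrCfg :=
  zip (.idle (decide (bitsValue l = 0))) [] (.mark :: l.map .bit)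

variable {B : ℕ}

theorem Run.single {c c' : CtrCfg} (h : c.step = c') (hB : c'.head ≤ B) : Run B c c' :=
  ReflTransGen.single ⟨h.symm, hB⟩

theorem Run.trans {a b c : CtrCfg} (hab : Run B a b) (hbc : Run B b c) : Run B a c :=
  ReflTransGen.trans hab hbc

theorem run_right {ph ph' : CtrPhase} {b b' : Bool}
    (h : ph.act (.bit b) = (ph', .bit b', .right)) (l r : List Bool) (hB : l.length + 2 ≤ B) :
    Run B (ofBits ph l (b :: r)) (ofBits ph' (l ++ [b']) r) := by
  refine Run.single ?_ (by simpa [ofBits, zip])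
  rw [ofBits, List.map_cons, step_zip h]
  simp [ofBits, zip, Move.work]

theorem run_right_end {ph ph' : CtrPhase} {b : Bool}
    (h : ph.act .blank = (ph', .bit b, .right)) (l : List Bool) (hB : l.length + 2 ≤ B) :
    Run B (ofBits ph l []) (ofBits ph' (l ++ [b]) []) := by
  refine Run.single ?_ (by simpa [ofBits, zip])
  rw [ofBits, List.map_nil, zip_nil, step_zip h]
  simp [ofBits, zip, Move.work]

theorem run_left {ph ph' : CtrPhase} {b : Bool}
    (h : ph.act (.bit b) = (ph', .bit b, .left)) (l r : List Bool) (e : Bool)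
    (hB : l.length + 1 ≤ B) :
    Run B (ofBits ph (l ++ [e]) (b :: r)) (ofBits ph' l (e :: b :: r)) := by
  refine Run.single ?_ (by simpa [ofBits, zip])
  rw [ofBits, List.map_cons, step_zip h]
  simp [ofBits, zip, Move.work]

theorem run_left_end {ph ph' : CtrPhase} (h : ph.act .blank = (ph', .blank, .left))
    (l : List Bool) (e : Bool) (hB : l.length + 1 ≤ B) :
    Run B (ofBits ph (l ++ [e]) []) (ofBits ph' l [e]) := by
  refine Run.single ?_ (by simpa [ofBits, zip])
  rw [ofBits, List.map_nil, zip_nil, step_zip h, tapeOf_append_blank]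
  simp [ofBits, zip, Move.work]

theorem run_leave_mark {ph : CtrPhase} (h : ph.act .mark = (ph, .mark, .right)) (l : List Bool)
    (hB : 1 ≤ B) : Run B ⟨ph, (idleOf l).tape, 0⟩ (ofBits ph [] l) := by
  refine Run.single (Eq.trans (step_zip h [] _) ?_) (by simpa [ofBits, zip])
  simp [ofBits, zip, Move.work]

theorem run_enter_mark (b : Bool) (r : List Bool) :
    Run B (ofBits (.back (decide (bitsValue r = 0))) [] (b :: r)) (idleOf (b :: r)) := by
  let stopped : CtrCfg := zip (.back (decide (bitsValue (b :: r) = 0))) []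
    (.mark :: (b :: r).map .bit)
  have h₁ : Run B (ofBits (.back (decide (bitsValue r = 0))) [] (b :: r)) stopped := by
    refine Run.single ?_ (Nat.zero_le _)
    rw [ofBits, List.map_cons, step_zip (b' := .bit b)
      (ph' := .back (decide (bitsValue (b :: r) = 0))) (mv := .left)]
    · simp [stopped, zip, Move.work]
    · cases b <;> simp [CtrPhase.act, bitsValue]
  exact h₁.trans (Run.single (step_zip rfl [] _) (Nat.zero_le _))

theorem run_back (l : List Bool) : ∀ (b : Bool) (r : List Bool), l.length ≤ B →
    Run B (ofBits (.back (decide (bitsValue r = 0))) l (b :: r)) (idleOf (l ++ b :: r)) := by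
  induction l using List.reverseRecOn with
  | nil => exact fun b r _ => run_enter_mark b r
  | append_singleton l e ih =>
    intro b r hB
    rw [List.length_append, List.length_singleton] at hB
    rw [List.append_assoc]
    refine (run_left (ph' := .back (decide (bitsValue (b :: r) = 0))) ?_ l r e hB).trans
      (ih e (b :: r) (by omega))
    cases b <;> simp [CtrPhase.act, bitsValue]

theorem run_toEnd (r : List Bool) : ∀ (l : List Bool), l.length + r.length + 1 ≤ B →
    l ++ r ≠ [] → Run B (ofBits .toEnd l r) (idleOf (l ++ r)) := by
  induction r with
  | nil =>
    intro l hB hl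
    rw [List.append_nil] at hl ⊢
    obtain ⟨l, e, rfl⟩ := (List.eq_nil_or_concat' l).resolve_left hl
    simp only [List.length_append, List.length_singleton, List.length_nil] at hB
    exact (run_left_end rfl l e (by omega)).trans (run_back l e [] (by omega))
  | cons b r ih =>
    intro l hB _
    rw [List.length_cons] at hB
    have h := ih (l ++ [b]) (by simp; omega) (by simp)
    rw [List.append_assoc] at h
    exact (run_right rfl l r (by omega)).trans h

theorem run_inc (r : List Bool) : ∀ (l : List Bool), l.length + (incBits r).length + 1 ≤ B →
    Run B (ofBits .inc l r) (idleOf (l ++ incBits r)) := by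
  fun_induction incBits r with
  | case1 =>
    intro l hB
    rw [List.length_singleton] at hB
    simpa using (run_right_end rfl l (by omega)).trans
      (run_toEnd [] (l ++ [true]) (by simp; omega) (by simp))
  | case2 r =>
    intro l hB
    rw [List.length_cons] at hB
    simpa using (run_right rfl l r (by omega)).trans
      (run_toEnd r (l ++ [true]) (by simp; omega) (by simp))
  | case3 r ih =>
    intro l hB
    rw [List.length_cons] at hB
    simpa using (run_right rfl l r (by omega)).trans (ih (l ++ [false]) (by simp; omega))

theorem run_dec (r : List Bool) : ∀ (l : List Bool), bitsValue r ≠ 0 →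
    l.length + r.length + 1 ≤ B → Run B (ofBits .dec l r) (idleOf (l ++ decBits r)) := by
  fun_induction decBits r with
  | case1 => exact fun _ h => absurd rfl h
  | case2 r =>
    intro l _ hB
    rw [List.length_cons] at hB
    simpa using (run_right rfl l r (by omega)).trans
      (run_toEnd r (l ++ [false]) (by simp; omega) (by simp))
  | case3 r ih =>
    intro l hr hB
    rw [List.length_cons] at hB
    have hr' : bitsValue r ≠ 0 := by simpa [bitsValue] using hr
    simpa using (run_right rfl l r (by omega)).trans (ih (l ++ [true]) hr' (by simp; omega))

theorem exists_run_begin {N : ℕ} {l : List Bool} (hl : l.length ≤ Nat.log 2 N + 1) (mv : Move)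
    (hN : mv.work (bitsValue l) ≤ N) :
    ∃ l' : List Bool, bitsValue l' = mv.work (bitsValue l) ∧ l'.length ≤ Nat.log 2 N + 1 ∧
      Run (Nat.log 2 N + 2)
        ⟨(idleOf l).phase.begin mv, (idleOf l).tape, 0⟩ (idleOf l') := by
  cases mv with
  | stay => exact ⟨l, rfl, hl, .refl⟩
  | right =>
    have hl' := length_incBits_le_log hl hN
    exact ⟨incBits l, bitsValue_incBits l, hl',
      (run_leave_mark rfl l (by omega)).trans (run_inc l [] (by simpa using by omega))⟩
  | left =>
    by_cases h0 : bitsValue l = 0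
    · refine ⟨l, by simp [Move.work, h0], hl, ?_⟩
      simp only [idleOf, zip, CtrPhase.begin, CtrPhase.isZero, h0]
      exact .refl
    · refine ⟨decBits l, bitsValue_decBits h0, (length_decBits l).trans_le hl, ?_⟩
      have hbegin : (idleOf l).phase.begin .left = .dec := by
        simp [idleOf, zip, CtrPhase.begin, CtrPhase.isZero, h0]
      rw [hbegin]
      exact (run_leave_mark rfl l (by omega)).trans (run_dec l [] h0 (by simpa using by omega))

theorem Run.exists_iterate {c e : CtrCfg} (h : Run B c e) (he : e.phase.IsIdle)
    (hc : c.head ≤ B) : ∃ T, step^[T] c = e ∧ ∀ t, (step^[t] c).head ≤ B := by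
  induction h using ReflTransGen.head_induction_on with
  | refl => exact ⟨0, rfl, fun t => by rwa [Function.iterate_fixed (step_of_isIdle he)]⟩
  | head h _ ih =>
    obtain ⟨T, hT, hb⟩ := ih h.2
    refine ⟨T + 1, by rw [Function.iterate_succ_apply, ← h.1, hT], fun t => ?_⟩
    cases t with
    | zero => exact hc
    | succ t => rw [Function.iterate_succ_apply, ← h.1]; exact hb t

end CtrCfg

/-! ### Counter automata in logarithmic space -/

namespace CounterAutomaton

variable {Γ : Type}

open Classical in
/-- The Turing machine that keeps every counter in binary on its own work tape. All counter tapes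
work in parallel, and the next instruction is executed when all of them are idle. -/
noncomputable def toLogTM (M : CounterAutomaton Γ) (F : Set M.Q) : TM Γ where
  Q := M.Q × (Fin M.m → CtrPhase)
  S := CtrSym
  k := M.m
  blank := .blank
  start := (M.start, fun _ => .blankTape)
  accepting := {q | q.1 ∈ F}
  δ := fun q i w =>
    if ∀ j, (q.2 j).IsIdle then
      {a | ∃ r ∈ M.δ q.1 i (fun j => (q.2 j).isZero),
        a = ⟨(r.1, fun j => (q.2 j).begin (r.2.2 j)), r.2.1, w, fun _ => .stay⟩}
    else
      {⟨(q.1, fun j => ((q.2 j).act (w j)).1), .stay, fun j => ((q.2 j).act (w j)).2.1,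
        fun j => ((q.2 j).act (w j)).2.2⟩}

variable {M : CounterAutomaton Γ} {F : Set M.Q} {x : List Γ} {B : ℕ} {q : M.Q} {p : ℕ}

theorem toLogTM_deterministic : (M.toLogTM F).Deterministic := by
  intro q i w a ha b hb
  simp only [toLogTM] at ha hb
  split_ifs at ha hb with h
  · obtain ⟨r, hr, rfl⟩ := ha
    obtain ⟨r', hr', rfl⟩ := hb
    rw [Option.mem_unique hr hr']
  · rw [ha, hb]

/-- The configuration assembled from the control state, the input head and the counter tapes. -/
def logCfg (F : Set M.Q) (q : M.Q) (p : ℕ) (L : Fin M.m → CtrCfg) : (M.toLogTM F).Cfg where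
  state := (q, fun j => (L j).phase)
  inHead := p
  tape := fun j => (L j).tape
  head := fun j => (L j).head

theorem spaceStep_of_not_idle {L : Fin M.m → CtrCfg} (h : ¬ ∀ j, (L j).phase.IsIdle)
    (hB : ∀ j, (L j).step.head ≤ B) :
    (M.toLogTM F).SpaceStep x B (logCfg F q p L) (logCfg F q p fun j => (L j).step) := by
  refine ⟨⟨⟨(q, fun j => (L j).step.phase), .stay,
    fun j => ((L j).phase.act ((L j).tape (L j).head)).2.1,
    fun j => ((L j).phase.act ((L j).tape (L j).head)).2.2⟩, ?_, rfl⟩, hB⟩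
  simp only [TM.actions, toLogTM, logCfg]
  rw [if_neg h]
  rfl

theorem reflTransGen_logCfg_iterate (T : ℕ) : ∀ {L : Fin M.m → CtrCfg},
    (∀ j, (CtrCfg.step^[T] (L j)).phase.IsIdle) →
    (∀ j t, (CtrCfg.step^[t] (L j)).head ≤ B) →
    ReflTransGen ((M.toLogTM F).SpaceStep x B) (logCfg F q p L)
      (logCfg F q p fun j => CtrCfg.step^[T] (L j)) := by
  induction T with
  | zero => exact fun _ _ => .refl
  | succ T ih =>
    intro L h1 h2
    by_cases h : ∀ j, (L j).phase.IsIdle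
    · rw [show (fun j => CtrCfg.step^[T + 1] (L j)) = L from
        funext fun j => Function.iterate_fixed (CtrCfg.step_of_isIdle (h j)) _]
    · exact .head (spaceStep_of_not_idle h fun j => h2 j 1) (ih h1 fun j t => h2 j (t + 1))

-- An idle counter waits, so all counters have finished after the sum of their running times.
theorem reflTransGen_logCfg_of_run {L E : Fin M.m → CtrCfg}
    (h : ∀ j, CtrCfg.Run B (L j) (E j)) (hE : ∀ j, (E j).phase.IsIdle)
    (hL : ∀ j, (L j).head ≤ B) :
    ReflTransGen ((M.toLogTM F).SpaceStep x B) (logCfg F q p L) (logCfg F q p E) := by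
  choose T hT hb using fun j => (h j).exists_iterate (hE j) (hL j)
  have hsum : ∀ j, CtrCfg.step^[∑ i, T i] (L j) = E j := fun j => by
    obtain ⟨k, hk⟩ := Nat.exists_eq_add_of_le'
      (Finset.single_le_sum (f := T) (fun _ _ => Nat.zero_le _) (Finset.mem_univ j))
    rw [hk, Function.iterate_add_apply, hT, Function.iterate_fixed (CtrCfg.step_of_isIdle (hE j))]
  have := reflTransGen_logCfg_iterate (F := F) (x := x) (q := q) (p := p) (∑ i, T i) (L := L)
    (fun j => by rw [hsum]; exact hE j) hb
  simpa only [hsum] using this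

/-- The configuration in which the idle counters hold the bits `l`. -/
def logIdle (F : Set M.Q) (q : M.Q) (p : ℕ) (l : Fin M.m → List Bool) : (M.toLogTM F).Cfg :=
  logCfg F q p fun j => CtrCfg.idleOf (l j)

/-- The action that starts to execute the instruction `r` on idle counters with bits `l`. -/
def logAction (l : Fin M.m → List Bool) (r : M.Q × Move × (Fin M.m → Move)) :
    Action (M.Q × (Fin M.m → CtrPhase)) CtrSym M.m where
  next := (r.1, fun j => (CtrCfg.idleOf (l j)).phase.begin (r.2.2 j))
  inMove := r.2.1
  write := fun j => (CtrCfg.idleOf (l j)).tape 0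
  move := fun _ => .stay

theorem actions_logIdle (l : Fin M.m → List Bool) :
    (M.toLogTM F).actions x (logIdle F q p l) =
      {a | ∃ r ∈ M.instr x ⟨q, p, fun j => bitsValue (l j)⟩, a = logAction l r} := by
  simp only [TM.actions, toLogTM]
  exact if_pos fun _ => trivial

theorem applyAction_logIdle (l : Fin M.m → List Bool) (r : M.Q × Move × (Fin M.m → Move)) :
    (M.toLogTM F).applyAction x (logIdle F q p l) (logAction l r) =
      logCfg F r.1 (r.2.1.input x.length p)
        fun j => ⟨(CtrCfg.idleOf (l j)).phase.begin (r.2.2 j), (CtrCfg.idleOf (l j)).tape, 0⟩ := by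
  simp only [TM.applyAction, logIdle, logCfg, logAction]
  congr 1
  exact funext fun j => Function.update_eq_self _ _

/-- The idle counters of `d` hold the counter values of `c`, in short binary. -/
def LogRepr (F : Set M.Q) (x : List Γ) (c : M.Cfg) (d : (M.toLogTM F).Cfg) : Prop :=
  ∃ l : Fin M.m → List Bool, d = logIdle F c.state c.pos l ∧ (∀ j, bitsValue (l j) = c.ctr j) ∧
    ∀ j, (l j).length ≤ Nat.log 2 (x.length + 1) + 1

/-- Runs of the Turing machine whose heads stay in the space needed for the counters. -/
def LogRun (F : Set M.Q) (x : List Γ) : (M.toLogTM F).Cfg → (M.toLogTM F).Cfg → Prop :=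
  ReflTransGen ((M.toLogTM F).SpaceStep x (Nat.log 2 (x.length + 1) + 2))

theorem LogRepr.exists_logRun {c c' : M.Cfg} {d : (M.toLogTM F).Cfg} (hd : LogRepr F x c d)
    (h : M.BStep x c c') : ∃ d', LogRepr F x c' d' ∧ LogRun F x d d' := by
  obtain ⟨l, rfl, hv, hl⟩ := hd
  obtain ⟨hs, hb⟩ := h
  obtain ⟨r, hr, rfl⟩ := Option.map_eq_some_iff.1 hs
  choose l' hv' hl' hrun using fun j => CtrCfg.exists_run_begin (hl j) (r.2.2 j) (by
    rw [hv]; exact hb j)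
  refine ⟨_, ⟨l', rfl, fun j => by rw [hv', hv]; rfl, hl'⟩,
    .head ⟨⟨logAction l r, ?_, (applyAction_logIdle l r).symm⟩, fun _ => Nat.zero_le _⟩
      (reflTransGen_logCfg_of_run hrun (fun _ => trivial) fun _ => Nat.zero_le _)⟩
  rw [actions_logIdle]
  exact ⟨r, by simp only [hv]; exact hr, rfl⟩

theorem exists_logRepr_initCfg :
    ∃ d, LogRepr F x M.initCfg d ∧ LogRun F x (M.toLogTM F).initCfg d := by
  refine ⟨_, ⟨fun _ => [], rfl, fun _ => rfl, fun _ => Nat.zero_le _⟩,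
    reflTransGen_logCfg_of_run (L := fun _ => ⟨.blankTape, fun _ => .blank, 0⟩) (fun j => ?_)
      (fun _ => trivial) fun _ => Nat.zero_le _⟩
  refine CtrCfg.Run.single ?_ (Nat.zero_le _)
  ext p
  · rfl
  · cases p <;> simp [CtrCfg.step, CtrPhase.act, CtrCfg.idleOf, CtrCfg.zip, CtrCfg.tapeOf]
  · rfl

theorem exists_logRun_of_bStep {c : M.Cfg} (h : ReflTransGen (M.BStep x) M.initCfg c) :
    ∃ d, LogRepr F x c d ∧ LogRun F x (M.toLogTM F).initCfg d := by
  induction h with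
  | refl => exact exists_logRepr_initCfg
  | tail _ h ih =>
    obtain ⟨d, hd, hrun⟩ := ih
    obtain ⟨d', hd', hrun'⟩ := hd.exists_logRun h
    exact ⟨d', hd', ReflTransGen.trans hrun hrun'⟩

theorem LogRepr.halted {c : M.Cfg} {d : (M.toLogTM F).Cfg} (hd : LogRepr F x c d)
    (hc : M.step x c = none) : (M.toLogTM F).Halted x d := by
  obtain ⟨l, rfl, hv, -⟩ := hd
  have hnone : M.instr x ⟨c.state, c.pos, fun j => bitsValue (l j)⟩ = none := by
    simp only [hv]
    exact Option.map_eq_none_iff.1 hc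
  rw [TM.Halted, actions_logIdle, hnone]
  exact Set.eq_empty_of_forall_notMem fun a ⟨_, hr, _⟩ => Option.not_mem_none _ hr

theorem HaltsIn.exists_logRun (h : M.HaltsIn x q) : ∃ d : (M.toLogTM F).Cfg,
    LogRun F x (M.toLogTM F).initCfg d ∧ (M.toLogTM F).Halted x d ∧ d.state.1 = q := by
  obtain ⟨c, hc, hn, rfl⟩ := h
  obtain ⟨d, hd, hrun⟩ := exists_logRun_of_bStep (F := F) hc
  refine ⟨d, hrun, hd.halted hn, ?_⟩
  obtain ⟨l, rfl, -⟩ := hd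
  rfl

theorem log_two_add_three_le (n : ℕ) : Nat.log 2 (n + 1) + 2 + 1 ≤ 4 * (Nat.log 2 n + 1) := by
  have : Nat.log 2 (n + 1) ≤ Nat.log 2 n + 1 := by
    rcases Nat.eq_zero_or_pos n with rfl | hn
    · simp
    · rw [← Nat.log_mul_base one_lt_two hn.ne']
      exact Nat.log_mono_right (by omega)
  omega

theorem inL_of_haltsIn (P : PromiseProblem) (M : CounterAutomaton P.Alphabet) (F : Set M.Q)
    (h : ∀ i, ∃ q, M.HaltsIn (P.encode i) q ∧ (i ∈ P.yes → q ∈ F) ∧ (i ∈ P.no → q ∉ F)) :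
    P.InL := by
  have hM := toLogTM_deterministic (F := F)
  choose q hq hyes hno using h
  choose d hrun hd hdq using fun i => (hq i).exists_logRun (F := F)
  have haccepts i : (M.toLogTM F).Accepts (P.encode i) ↔ q i ∈ F := by
    rw [hM.accepts_iff (hd i) (hrun i), ← hdq]
    rfl
  exact ⟨M.toLogTM F, 4, hM, fun i => (hd i).halts (hrun i),
    fun i t c hc j => (hM.runsInSpace (hd i) (hrun i) t c hc j).trans_le (log_two_add_three_le _),
    fun i hi => (haccepts i).2 (hyes i hi), fun i hi => mt (haccepts i).1 (hno i hi)⟩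

end CounterAutomaton

/-! ### The running time of a halting counter automaton -/

-- A repetition before the fixed point would make the orbit periodic, and it would never reach `z`.
theorem injOn_iterate_of_isFixedPt {α : Type*} {f : α → α} {z a : α} {T : ℕ}
    (hz : Function.IsFixedPt f z) (hT : f^[T] a = z) :
    Set.InjOn (fun t => f^[t] a) {t | f^[t] a ≠ z} := by
  have hlt : ∀ s t, s < t → f^[s] a ≠ z → f^[s] a ≠ f^[t] a := by
    intro s t hst hs hrep
    have hper : Function.IsPeriodicPt f (t - s) (f^[s] a) := by
      rw [Function.IsPeriodicPt, Function.IsFixedPt, ← Function.iterate_add_apply,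
        Nat.sub_add_cancel hst.le, hrep]
    have hle : T ≤ (t - s) * T + s :=
      (Nat.le_mul_of_pos_left T (Nat.sub_pos_of_lt hst)).trans (Nat.le_add_right _ _)
    apply hs
    calc f^[s] a = f^[(t - s) * T] (f^[s] a) := (hper.mul_const T).symm
      _ = f^[(t - s) * T + s - T] (f^[T] a) := by
        rw [← Function.iterate_add_apply, ← Function.iterate_add_apply, Nat.sub_add_cancel hle]
      _ = z := by rw [hT, hz.iterate]
  intro s hs t ht hst
  rcases lt_trichotomy s t with h | h | h
  · exact absurd hst (hlt s t h hs)
  · exact h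
  · exact absurd hst.symm (hlt t s h ht)

theorem Move.input_le {n p : ℕ} (mv : Move) (hp : p ≤ n + 1) : mv.input n p ≤ n + 1 := by
  cases mv <;> simp only [Move.input] <;> omega

namespace CounterAutomaton

variable {Γ : Type} {M : CounterAutomaton Γ} {x : List Γ}

/-- The step function extended by `none`, so that a computation can be iterated past its end. -/
def next (M : CounterAutomaton Γ) (x : List Γ) (o : Option M.Cfg) : Option M.Cfg :=
  o.bind (M.step x)

/-- The configuration `b` is reached from `a` in some number of steps. -/
def Reaches (M : CounterAutomaton Γ) (x : List Γ) (a b : M.Cfg) : Prop :=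
  ReflTransGen (fun u v => M.step x u = some v) a b

theorem exists_iterate_next_iff {a c : M.Cfg} :
    (∃ t, (M.next x)^[t] (some a) = some c) ↔ M.Reaches x a c := by
  constructor
  · rintro ⟨t, h⟩
    induction t generalizing c with
    | zero =>
      obtain rfl := Option.some.inj h
      exact .refl
    | succ t ih =>
      rw [Function.iterate_succ_apply'] at h
      obtain ⟨d, hd, hs⟩ := Option.bind_eq_some_iff.1 h
      exact (ih hd).tail hs
  · intro h
    induction h with
    | refl => exact ⟨0, rfl⟩
    | tail _ hs ih =>
      obtain ⟨t, ht⟩ := ih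
      exact ⟨t + 1, by rw [Function.iterate_succ_apply', ht, next, Option.bind_some, hs]⟩

/-- The input head and all counters are at most the length of the input plus one. -/
def Cfg.InBounds (x : List Γ) (c : M.Cfg) : Prop :=
  c.pos ≤ x.length + 1 ∧ ∀ j, c.ctr j ≤ x.length + 1

theorem Reaches.pos_le {c : M.Cfg} (h : M.Reaches x M.initCfg c) : c.pos ≤ x.length + 1 := by
  induction h with
  | refl => exact Nat.zero_le _
  | tail _ hs ih =>
    obtain ⟨r, -, rfl⟩ := Option.map_eq_some_iff.1 hs
    exact r.2.1.input_le ih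

theorem HaltsIn.ctr_le_and_reaches {q : M.Q} (h : M.HaltsIn x q) {c : M.Cfg}
    (hc : M.Reaches x M.initCfg c) :
    (∀ j, c.ctr j ≤ x.length + 1) ∧ ∃ e, M.Reaches x c e ∧ M.step x e = none ∧ e.state = q := by
  obtain ⟨e, he, hn, hq⟩ := h
  obtain ⟨hle, hce⟩ := of_maximal_run (P := fun c : M.Cfg => ∀ j, c.ctr j ≤ x.length + 1)
    (fun a b d hb hd => Option.some.inj (hb.symm.trans hd)) he (fun _ => Nat.zero_le _)
    (fun d hd => by simp [hn] at hd) hc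
  exact ⟨hle, e, hce, hn, hq⟩

theorem HaltsIn.state_eq {q : M.Q} (h : M.HaltsIn x q) {c : M.Cfg}
    (hc : M.Reaches x M.initCfg c) (hn : M.step x c = none) : c.state = q := by
  obtain ⟨-, e, hce, -, rfl⟩ := h.ctr_le_and_reaches hc
  rcases hce.cases_head with rfl | ⟨d, hd, -⟩
  · rfl
  · cases hn.symm.trans hd

theorem HaltsIn.exists_reaches {q : M.Q} (h : M.HaltsIn x q) :
    ∃ e, M.Reaches x M.initCfg e ∧ M.step x e = none ∧ e.state = q :=
  (h.ctr_le_and_reaches .refl).2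

theorem HaltsIn.unique {q q' : M.Q} (h : M.HaltsIn x q) (h' : M.HaltsIn x q') : q = q' := by
  obtain ⟨e, he, hn, rfl⟩ := h.exists_reaches
  exact h'.state_eq he hn

theorem HaltsIn.inBounds {q : M.Q} (h : M.HaltsIn x q) {c : M.Cfg}
    (hc : M.Reaches x M.initCfg c) : c.InBounds x :=
  ⟨hc.pos_le, (h.ctr_le_and_reaches hc).1⟩

theorem HaltsIn.exists_iterate_next_eq_none {q : M.Q} (h : M.HaltsIn x q) :
    ∃ T, (M.next x)^[T] (some M.initCfg) = none := by
  obtain ⟨e, he, hn, -⟩ := h.exists_reaches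
  obtain ⟨T, hT⟩ := exists_iterate_next_iff.2 he
  exact ⟨T + 1, by rw [Function.iterate_succ_apply', hT, next, Option.bind_some, hn]⟩

/-- The finitely many data of a configuration within bounds. -/
def Cfg.InBounds.data (c : {c : M.Cfg // c.InBounds x}) :
    M.Q × Fin (x.length + 2) × (Fin M.m → Fin (x.length + 2)) :=
  (c.1.state, ⟨c.1.pos, Nat.lt_succ_of_le c.2.1⟩,
    fun j => ⟨c.1.ctr j, Nat.lt_succ_of_le (c.2.2 j)⟩)

theorem Cfg.InBounds.data_injective :
    Function.Injective (data : {c : M.Cfg // c.InBounds x} → _) := by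
  rintro ⟨c, hc⟩ ⟨d, hd⟩ h
  simp only [data, Prod.mk.injEq, Fin.mk.injEq] at h
  exact Subtype.ext (Cfg.ext h.1 h.2.1 (funext fun j => Fin.mk.inj (congrFun h.2.2 j)))

theorem HaltsIn.iterate_next_lt {q : M.Q} (h : M.HaltsIn x q) {t : ℕ} {c : M.Cfg}
    (ht : (M.next x)^[t] (some M.initCfg) = some c) :
    t < Nat.card M.Q * (x.length + 2) ^ (M.m + 1) := by
  obtain ⟨T, hT⟩ := h.exists_iterate_next_eq_none
  have hnone : Function.IsFixedPt (M.next x) none := rfl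
  have hsome : ∀ i : Fin (t + 1), (M.next x)^[i] (some M.initCfg) ≠ none := by
    intro i hi
    rw [← Nat.sub_add_cancel (Nat.lt_succ_iff.1 i.2), Function.iterate_add_apply, hi,
      hnone.iterate] at ht
    cases ht
  choose d hd using fun i => Option.ne_none_iff_exists.1 (hsome i)
  let orbit (i : Fin (t + 1)) : {c : M.Cfg // c.InBounds x} :=
    ⟨d i, h.inBounds (exists_iterate_next_iff.1 ⟨i, (hd i).symm⟩)⟩
  have horbit : Function.Injective orbit := fun i k hik => by
    have hdd : d i = d k := congrArg Subtype.val hik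
    exact Fin.ext (injOn_iterate_of_isFixedPt hnone hT (hsome i) (hsome k)
      (by simp only [← hd, hdd]))
  have := Nat.card_le_card_of_injective _ (Cfg.InBounds.data_injective.comp horbit)
  simpa [Nat.card_prod, Nat.card_fun, ← pow_succ'] using this

end CounterAutomaton

/-! ### Nondeterministic Turing machines from counter automata -/

/-- The states of the Turing machine that guesses an annotation of its input and then simulates a
counter automaton with states `Q`. -/
inductive GuessState (Q : Type) : Type
  | start : GuessState Q
  | copy : GuessState Q
  | rewind : GuessState Q
  | run (q : Q) : GuessState Q
  deriving Fintype

instance GuessState.finite (Q : Type) [Finite Q] : Finite (GuessState Q) :=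
  have := Fintype.ofFinite Q
  inferInstance

instance InSym.finite (Γ : Type) [Finite Γ] : Finite (InSym Γ) :=
  Finite.of_surjective (fun s : Bool ⊕ Γ => s.elim (cond · leftEnd rightEnd) sym) fun
    | leftEnd => ⟨.inl true, rfl⟩
    | rightEnd => ⟨.inl false, rfl⟩
    | sym g => ⟨.inr g, rfl⟩

/-- The zero test for a head position, performed on the symbol under the head. -/
def InSym.isLeftEnd {Γ : Type} : InSym Γ → Bool
  | leftEnd => true
  | _ => false

/-- The move of an input head, carried out by a work head: it does not cross the right end
marker. -/
def Move.clamp {Γ : Type} : InSym Γ → Move → Move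
  | .rightEnd, .right => .stay
  | _, mv => mv

section readInput

variable {Γ : Type} {x : List Γ} {p : ℕ}

theorem readInput_of_lt (h : p < x.length) : readInput x (p + 1) = .sym x[p] := by
  simp [readInput, h]

theorem readInput_of_ge (h : x.length ≤ p) : readInput x (p + 1) = .rightEnd := by
  simp [readInput, h]

theorem isLeftEnd_readInput : (readInput x p).isLeftEnd = decide (p = 0) := by
  cases p with
  | zero => rfl
  | succ p =>
    rcases Nat.lt_or_ge p x.length with h | h
    · simp [readInput_of_lt h, InSym.isLeftEnd]
    · simp [readInput_of_ge h, InSym.isLeftEnd]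

theorem clamp_work_readInput (hp : p ≤ x.length + 1) (mv : Move) :
    (mv.clamp (readInput x p)).work p = mv.input x.length p := by
  cases p with
  | zero => cases mv <;> simp [readInput, Move.clamp, Move.work, Move.input]
  | succ p =>
    rcases Nat.lt_or_ge p x.length with h | h
    · rw [readInput_of_lt h]
      cases mv <;> simp only [Move.clamp, Move.work, Move.input]
      omega
    · rw [readInput_of_ge h]
      cases mv <;> simp only [Move.clamp, Move.work, Move.input]
      omega

theorem update_readInput (g : Γ) :
    Function.update (readInput x) (x.length + 1) (.sym g) = readInput (x ++ [g]) := by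
  funext p
  cases p with
  | zero => rfl
  | succ p =>
    rcases lt_trichotomy p x.length with h | rfl | h
    · rw [Function.update_of_ne (by omega)]
      simp [readInput, List.getElem?_append_left h]
    · simp [readInput]
    · rw [Function.update_of_ne (by omega), readInput_of_ge h.le, readInput_of_ge (by simp; omega)]

end readInput

namespace CounterAutomaton

variable {Γ D : Type} [Finite Γ] [Finite D]

/-- The nondeterministic Turing machine that writes a guessed annotation of its input on work tape
`0` and runs the counter automaton on it, using the head positions on the other tapes as
counters. The left end marker, written in the first step, marks the zero of each counter. -/
def toGuessTM (M : CounterAutomaton (Γ × D)) (F : Set M.Q) : TM Γ where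
  Q := GuessState M.Q
  S := InSym (Γ × D)
  k := M.m + 1
  blank := .rightEnd
  start := .start
  accepting := {q | ∃ q' ∈ F, q = .run q'}
  δ := fun q i w => match q with
    | .start => {⟨.copy, .right, fun _ => .leftEnd, Fin.cons .right fun _ => .stay⟩}
    | .copy => match i with
      | .leftEnd => ∅
      | .sym g => {a | ∃ d, a = ⟨.copy, .right, Fin.cons (.sym (g, d)) (Fin.tail w),
          Fin.cons .right fun _ => .stay⟩}
      | .rightEnd => {⟨.rewind, .stay, w, Fin.cons .stay fun _ => .stay⟩}
    | .rewind =>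
      if (w 0).isLeftEnd then {⟨.run M.start, .stay, w, Fin.cons .stay fun _ => .stay⟩}
      else {⟨.rewind, .stay, w, Fin.cons .left fun _ => .stay⟩}
    | .run q => {a | ∃ r ∈ M.δ q (w 0) (fun j => (w j.succ).isLeftEnd),
        a = ⟨.run r.1, .stay, w, Fin.cons (r.2.1.clamp (w 0)) r.2.2⟩}

variable {M : CounterAutomaton (Γ × D)} {F : Set M.Q} {x : List Γ} {y : List (Γ × D)}
  {p h : ℕ} {n : Fin M.m → ℕ} {c' : (M.toGuessTM F).Cfg}

/-- The configuration of the guessing machine with the annotated word `y` on work tape `0`, whose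
head is in cell `h`, and with counters `n`. -/
def guessCfg (F : Set M.Q) (q : GuessState M.Q) (p : ℕ) (y : List (Γ × D)) (h : ℕ)
    (n : Fin M.m → ℕ) : (M.toGuessTM F).Cfg where
  state := q
  inHead := p
  tape := Fin.cons (α := fun _ => ℕ → InSym (Γ × D)) (readInput y) fun _ => readInput []
  head := Fin.cons (α := fun _ => ℕ) h n

/-- The symbols under the work heads in `guessCfg`. -/
def guessRead (M : CounterAutomaton (Γ × D)) (y : List (Γ × D)) (h : ℕ) (n : Fin M.m → ℕ) :
    Fin (M.m + 1) → InSym (Γ × D) :=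
  Fin.cons (readInput y h) fun j => readInput [] (n j)

/-- The action of the guessing machine with the given components. -/
def guessAct (F : Set M.Q) (q : GuessState M.Q) (mi : Move) (w : Fin (M.m + 1) → InSym (Γ × D))
    (mv : Move) (cm : Fin M.m → Move) :
    Action (M.toGuessTM F).Q (M.toGuessTM F).S (M.toGuessTM F).k :=
  ⟨q, mi, w, Fin.cons (α := fun _ => Move) mv cm⟩

theorem actions_guessCfg (q : GuessState M.Q) : (M.toGuessTM F).actions x (guessCfg F q p y h n) =
    (M.toGuessTM F).δ q (readInput x p) (guessRead M y h n) := by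
  have hread : (fun j => (guessCfg F q p y h n).tape j ((guessCfg F q p y h n).head j)) =
      guessRead M y h n := by
    funext j
    refine Fin.cases ?_ (fun j => ?_) j <;> rfl
  rw [TM.actions, hread]
  rfl

theorem applyAction_guessCfg (q q' : GuessState M.Q) (mi mv : Move) (cm : Fin M.m → Move) :
    (M.toGuessTM F).applyAction x (guessCfg F q p y h n)
        (guessAct F q' mi (guessRead M y h n) mv cm) =
      guessCfg F q' (mi.input x.length p) y (mv.work h) fun j => (cm j).work (n j) := by
  simp only [TM.applyAction, guessCfg, guessAct]
  congr 1
  · funext j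
    refine Fin.cases ?_ (fun j => ?_) j <;> exact Function.update_eq_self _ _
  · funext j
    refine Fin.cases ?_ (fun j => ?_) j <;> rfl

theorem applyAction_copy (b : Γ × D) :
    (M.toGuessTM F).applyAction x (guessCfg F .copy p y (y.length + 1) n)
        (guessAct F .copy .right
          (Fin.cons (.sym b) (Fin.tail (guessRead M y (y.length + 1) n))) .right fun _ => .stay) =
      guessCfg F .copy (Move.right.input x.length p) (y ++ [b]) ((y ++ [b]).length + 1) n := by
  simp only [TM.applyAction, guessCfg, guessAct]
  congr 1
  · funext j
    refine Fin.cases ?_ (fun j => ?_) j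
    · exact update_readInput b
    · exact Function.update_eq_self _ _
  · funext j
    refine Fin.cases ?_ (fun j => ?_) j
    · simp [Move.work]
    · rfl

theorem applyAction_start :
    (M.toGuessTM F).applyAction x (M.toGuessTM F).initCfg
        (guessAct F .copy .right (fun _ => .leftEnd) .right fun _ => .stay) =
      guessCfg F .copy 1 [] 1 fun _ => 0 := by
  simp only [TM.applyAction, guessCfg, TM.initCfg, guessAct]
  congr 1
  · funext j p
    refine Fin.cases ?_ (fun j => ?_) j <;> cases p <;> rfl
  · funext j
    refine Fin.cases ?_ (fun j => ?_) j <;> rfl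

theorem step_initCfg_iff :
    (M.toGuessTM F).Step x (M.toGuessTM F).initCfg c' ↔
      c' = guessCfg F .copy 1 [] 1 fun _ => 0 := by
  have ha : (M.toGuessTM F).actions x (M.toGuessTM F).initCfg =
      {guessAct F .copy .right (fun _ => .leftEnd) .right fun _ => .stay} := rfl
  simp only [TM.Step, ha, Set.mem_singleton_iff, exists_eq_left, applyAction_start]

theorem step_copy_iff {z : List Γ} {g : Γ} (hx : y.map Prod.fst ++ g :: z = x) :
    (M.toGuessTM F).Step x (guessCfg F .copy (y.length + 1) y (y.length + 1) n) c' ↔ ∃ d, c' =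
      guessCfg F .copy ((y ++ [(g, d)]).length + 1) (y ++ [(g, d)])
        ((y ++ [(g, d)]).length + 1) n := by
  have hread : readInput x (y.length + 1) = .sym g := by
    rw [readInput_of_lt (by simp [← hx])]
    simp [← hx]
  have ha : (M.toGuessTM F).actions x (guessCfg F .copy (y.length + 1) y (y.length + 1) n) =
      {a | ∃ d, a = guessAct F .copy .right (Fin.cons (.sym (g, d))
        (Fin.tail (guessRead M y (y.length + 1) n))) .right fun _ => .stay} := by
    rw [actions_guessCfg, hread]
    rfl
  have hmove : ∀ d : D, (y ++ [(g, d)]).length + 1 = Move.right.input x.length (y.length + 1) := by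
    simp [← hx, Move.input]
  simp only [TM.Step, ha, Set.mem_ofPred_eq]
  constructor
  · rintro ⟨_, ⟨d, rfl⟩, rfl⟩
    exact ⟨d, by rw [applyAction_copy, ← hmove d]⟩
  · rintro ⟨d, rfl⟩
    exact ⟨_, ⟨d, rfl⟩, by rw [applyAction_copy, ← hmove d]⟩

theorem step_copy_end_iff (hx : readInput x p = .rightEnd) :
    (M.toGuessTM F).Step x (guessCfg F .copy p y h n) c' ↔ c' = guessCfg F .rewind p y h n := by
  have ha : (M.toGuessTM F).actions x (guessCfg F .copy p y h n) =
      {guessAct F .rewind .stay (guessRead M y h n) .stay fun _ => .stay} := by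
    rw [actions_guessCfg, hx]
    rfl
  simp only [TM.Step, ha, Set.mem_singleton_iff, exists_eq_left, applyAction_guessCfg]
  rfl

theorem step_rewind_zero_iff :
    (M.toGuessTM F).Step x (guessCfg F .rewind p y 0 n) c' ↔
      c' = guessCfg F (.run M.start) p y 0 n := by
  have ha : (M.toGuessTM F).actions x (guessCfg F .rewind p y 0 n) =
      {guessAct F (.run M.start) .stay (guessRead M y 0 n) .stay fun _ => .stay} := by
    rw [actions_guessCfg]
    rfl
  simp only [TM.Step, ha, Set.mem_singleton_iff, exists_eq_left, applyAction_guessCfg]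
  rfl

theorem step_rewind_succ_iff :
    (M.toGuessTM F).Step x (guessCfg F .rewind p y (h + 1) n) c' ↔
      c' = guessCfg F .rewind p y h n := by
  have hread : ¬ (guessRead M y (h + 1) n 0).isLeftEnd := by
    simp only [guessRead, Fin.cons_zero, isLeftEnd_readInput, decide_eq_true_eq]
    exact Nat.succ_ne_zero h
  have ha : (M.toGuessTM F).actions x (guessCfg F .rewind p y (h + 1) n) =
      {guessAct F .rewind .stay (guessRead M y (h + 1) n) .left fun _ => .stay} := by
    rw [actions_guessCfg]
    exact if_neg hread
  simp only [TM.Step, ha, Set.mem_singleton_iff, exists_eq_left, applyAction_guessCfg]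
  rfl

/-- The configuration of the guessing machine that represents a configuration of the counter
automaton on the annotated word `y`. -/
def runCfg (F : Set M.Q) (p : ℕ) (y : List (Γ × D)) (c : M.Cfg) : (M.toGuessTM F).Cfg :=
  guessCfg F (.run c.state) p y c.pos c.ctr

theorem actions_runCfg (c : M.Cfg) :
    (M.toGuessTM F).actions x (runCfg F p y c) =
      {a | ∃ r ∈ M.instr y c, a = guessAct F (.run r.1) .stay (guessRead M y c.pos c.ctr)
        (r.2.1.clamp (readInput y c.pos)) r.2.2} := by
  have hinstr : M.δ c.state (guessRead M y c.pos c.ctr 0)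
      (fun j => (guessRead M y c.pos c.ctr j.succ).isLeftEnd) = M.instr y c := by
    simp only [instr, guessRead, Fin.cons_zero, Fin.cons_succ, isLeftEnd_readInput]
  rw [runCfg, actions_guessCfg, ← hinstr]
  rfl

theorem step_runCfg_iff {c : M.Cfg} (hc : c.pos ≤ y.length + 1) :
    (M.toGuessTM F).Step x (runCfg F p y c) c' ↔ ∃ e ∈ M.step y c, c' = runCfg F p y e := by
  have happly : ∀ r : M.Q × Move × (Fin M.m → Move),
      (M.toGuessTM F).applyAction x (runCfg F p y c) (guessAct F (.run r.1) .stay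
        (guessRead M y c.pos c.ctr) (r.2.1.clamp (readInput y c.pos)) r.2.2) =
      runCfg F p y (M.exec y c r) := by
    intro r
    rw [runCfg, applyAction_guessCfg, clamp_work_readInput hc]
    rfl
  simp only [TM.Step, actions_runCfg, Set.mem_ofPred_eq]
  constructor
  · rintro ⟨_, ⟨r, hr, rfl⟩, rfl⟩
    exact ⟨M.exec y c r, Option.mem_map_of_mem _ hr, happly r⟩
  · rintro ⟨e, he, rfl⟩
    obtain ⟨r, hr, rfl⟩ := Option.map_eq_some_iff.1 he
    exact ⟨_, ⟨r, hr, rfl⟩, (happly r).symm⟩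

theorem halted_runCfg_iff {c : M.Cfg} :
    (M.toGuessTM F).Halted x (runCfg F p y c) ↔ M.step y c = none := by
  rw [TM.Halted, actions_runCfg, step, Option.map_eq_none_iff, Set.eq_empty_iff_forall_notMem,
    Option.eq_none_iff_forall_not_mem]
  exact ⟨fun h r hr => h _ ⟨r, hr, rfl⟩, fun h _ ⟨r, hr, _⟩ => h r hr⟩

/-- The configurations of the guessing machine that are reachable in exactly the given time; in
`copy` the part `z` of the input is still to be read. -/
inductive GuessReaches (F : Set M.Q) (x : List Γ) : ℕ → (M.toGuessTM F).Cfg → Prop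
  | initial : GuessReaches F x 0 (M.toGuessTM F).initCfg
  | copy (y : List (Γ × D)) (z : List Γ) (h : y.map Prod.fst ++ z = x) :
      GuessReaches F x (y.length + 1)
        (guessCfg F .copy (y.length + 1) y (y.length + 1) fun _ => 0)
  | rewind (y : List (Γ × D)) (h : y.map Prod.fst = x) (k l : ℕ) (hl : k + l = x.length + 1) :
      GuessReaches F x (x.length + 2 + k) (guessCfg F .rewind (x.length + 1) y l fun _ => 0)
  | run (y : List (Γ × D)) (h : y.map Prod.fst = x) (t : ℕ) (c : M.Cfg)
      (ht : (M.next y)^[t] (some M.initCfg) = some c) :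
      GuessReaches F x (2 * x.length + 4 + t) (runCfg F (x.length + 1) y c)

theorem GuessReaches.step {t : ℕ} {c c' : (M.toGuessTM F).Cfg} (h : GuessReaches F x t c)
    (hs : (M.toGuessTM F).Step x c c') : GuessReaches F x (t + 1) c' := by
  cases h with
  | initial =>
    obtain rfl := step_initCfg_iff.1 hs
    exact .copy [] x rfl
  | copy y z h =>
    cases z with
    | nil =>
      rw [List.append_nil] at h
      have hl : y.length = x.length := by rw [← h, List.length_map]
      obtain rfl := (step_copy_end_iff (readInput_of_ge hl.ge)).1 hs
      rw [hl]
      exact .rewind y h 0 (x.length + 1) (Nat.zero_add _)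
    | cons g z =>
      obtain ⟨d, rfl⟩ := (step_copy_iff h).1 hs
      rw [show y.length + 1 = (y ++ [(g, d)]).length by rw [List.length_append]; rfl]
      exact .copy (y ++ [(g, d)]) z (by simpa using h)
  | rewind y h k l hl =>
    cases l with
    | zero =>
      obtain rfl := step_rewind_zero_iff.1 hs
      have ht : x.length + 2 + k + 1 = 2 * x.length + 4 + 0 := by omega
      rw [ht]
      exact .run y h 0 M.initCfg rfl
    | succ l =>
      obtain rfl := step_rewind_succ_iff.1 hs
      exact .rewind y h (k + 1) l (by omega)
  | run y h t c ht =>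
    obtain ⟨e, he, rfl⟩ := (step_runCfg_iff (exists_iterate_next_iff.1 ⟨t, ht⟩).pos_le).1 hs
    exact .run y h (t + 1) e (by rw [Function.iterate_succ_apply', ht]; exact he)

theorem GuessReaches.of_reachesIn {t : ℕ} {c : (M.toGuessTM F).Cfg}
    (h : (M.toGuessTM F).ReachesIn x t c) : GuessReaches F x t c := by
  induction t generalizing c with
  | zero =>
    obtain rfl : c = _ := h
    exact .initial
  | succ t ih =>
    obtain ⟨c', h', hs⟩ := h
    exact (ih h').step hs

theorem reachesIn_copy {z : List Γ} (h : y.map Prod.fst ++ z = x) :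
    (M.toGuessTM F).ReachesIn x (y.length + 1)
      (guessCfg F .copy (y.length + 1) y (y.length + 1) fun _ => 0) := by
  induction y using List.reverseRecOn generalizing z with
  | nil => exact ⟨_, rfl, step_initCfg_iff.2 rfl⟩
  | append_singleton y b ih =>
    rw [List.map_append, List.append_assoc] at h
    rw [List.length_append]
    exact ⟨_, ih h, (step_copy_iff h).2 ⟨b.2, by rw [List.length_append]⟩⟩

theorem reachesIn_rewind (h : y.map Prod.fst = x) {k l : ℕ} (hl : k + l = x.length + 1) :
    (M.toGuessTM F).ReachesIn x (x.length + 2 + k)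
      (guessCfg F .rewind (x.length + 1) y l fun _ => 0) := by
  induction k generalizing l with
  | zero =>
    have hlen : y.length = x.length := by rw [← h, List.length_map]
    obtain rfl : l = x.length + 1 := by omega
    rw [← hlen]
    exact ⟨_, reachesIn_copy (z := []) (by rw [h, List.append_nil]),
      (step_copy_end_iff (readInput_of_ge hlen.ge)).2 rfl⟩
  | succ k ih => exact ⟨_, ih (l := l + 1) (by omega), step_rewind_succ_iff.2 rfl⟩

theorem reachesIn_run (h : y.map Prod.fst = x) {t : ℕ} {c : M.Cfg}
    (ht : (M.next y)^[t] (some M.initCfg) = some c) :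
    (M.toGuessTM F).ReachesIn x (2 * x.length + 4 + t) (runCfg F (x.length + 1) y c) := by
  induction t generalizing c with
  | zero =>
    obtain rfl := Option.some.inj ht
    have htime : 2 * x.length + 4 + 0 = x.length + 2 + (x.length + 1) + 1 := by omega
    rw [htime]
    exact ⟨_, reachesIn_rewind h (Nat.add_zero _), step_rewind_zero_iff.2 rfl⟩
  | succ t ih =>
    rw [Function.iterate_succ_apply'] at ht
    obtain ⟨d, hd, hs⟩ := Option.bind_eq_some_iff.1 ht
    exact ⟨_, ih hd, (step_runCfg_iff (exists_iterate_next_iff.1 ⟨t, hd⟩).pos_le).2 ⟨c, hs, rfl⟩⟩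

theorem runsInTime_toGuessTM (hhalt : ∀ y, y.map Prod.fst = x → ∃ q, M.HaltsIn y q) :
    (M.toGuessTM F).RunsInTime x
      (2 * x.length + 4 + Nat.card M.Q * (x.length + 2) ^ (M.m + 1)) := by
  intro t c hc
  cases GuessReaches.of_reachesIn hc with
  | initial => exact Nat.zero_le _
  | copy y z h =>
    have : y.length ≤ x.length := by simp [← h]
    omega
  | rewind y h k l hl => omega
  | run y h t c ht =>
    obtain ⟨q, hq⟩ := hhalt y h
    have := hq.iterate_next_lt ht
    rw [show y.length = x.length by rw [← h, List.length_map]] at this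
    omega

theorem accepts_toGuessTM {q : M.Q} (hy : y.map Prod.fst = x) (h : M.HaltsIn y q) (hq : q ∈ F) :
    (M.toGuessTM F).Accepts x := by
  obtain ⟨e, he, hs, rfl⟩ := h.exists_reaches
  obtain ⟨t, ht⟩ := exists_iterate_next_iff.2 he
  exact ⟨_, _, reachesIn_run hy ht, halted_runCfg_iff.2 hs, e.state, hq, rfl⟩

theorem exists_haltsIn_of_accepts (hhalt : ∀ y, y.map Prod.fst = x → ∃ q, M.HaltsIn y q)
    (h : (M.toGuessTM F).Accepts x) :
    ∃ y, y.map Prod.fst = x ∧ ∃ q ∈ F, M.HaltsIn y q := by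
  obtain ⟨t, c, hc, hh, q, hq, hcq⟩ := h
  cases GuessReaches.of_reachesIn hc with
  | initial => cases hcq
  | copy y z h => cases hcq
  | rewind y h k l hl => cases hcq
  | run y h t c ht =>
    obtain rfl : c.state = q := GuessState.run.inj hcq
    obtain ⟨q', hq'⟩ := hhalt y h
    obtain rfl := hq'.state_eq (exists_iterate_next_iff.1 ⟨t, ht⟩) (halted_runCfg_iff.1 hh)
    exact ⟨y, h, c.state, hq, hq'⟩

theorem inNP_of_haltsIn (P : PromiseProblem) {D : Type} [Finite D]
    (M : CounterAutomaton (P.Alphabet × D)) (F : Set M.Q)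
    (hhalt : ∀ i y, y.map Prod.fst = P.encode i → ∃ q, M.HaltsIn y q ∧ (i ∈ P.no → q ∉ F))
    (hyes : ∀ i ∈ P.yes, ∃ y, y.map Prod.fst = P.encode i ∧ ∃ q ∈ F, M.HaltsIn y q) :
    P.InNP := by
  have := P.finiteAlphabet
  have hhalt' : ∀ i y, y.map Prod.fst = P.encode i → ∃ q, M.HaltsIn y q := fun i y h =>
    (hhalt i y h).imp fun _ hq => hq.1
  refine ⟨M.toGuessTM F, 2 * .X + 4 + .C (Nat.card M.Q) * (.X + 2) ^ (M.m + 1),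
    fun i => ?_, fun i hi => ?_, fun i hi hacc => ?_⟩
  · simpa using runsInTime_toGuessTM (F := F) (hhalt' i)
  · obtain ⟨y, hy, q, hq, hrun⟩ := hyes i hi
    exact accepts_toGuessTM hy hrun hq
  · obtain ⟨y, hy, q, hq, hrun⟩ := exists_haltsIn_of_accepts (hhalt' i) hacc
    obtain ⟨q', hrun', hno⟩ := hhalt i y hy
    exact hno hi (hrun.unique hrun' ▸ hq)

end CounterAutomaton

/-! ### Evaluating a formula with a counter automaton -/

namespace Fml

variable {σ : Signature}

/-- The disjunction (`z = true`) or conjunction (`z = false`) of two formulas; `z` is the truth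
value of the left one that determines the result. -/
def binary : Bool → Fml σ → Fml σ → Fml σ
  | true => or
  | false => and

/-- The existential (`z = true`) or universal (`z = false`) quantification of a formula. -/
def quant : Bool → ℕ → Fml σ → Fml σ
  | true => ex
  | false => all

@[elab_as_elim]
theorem binary_quant_induction {motive : Fml σ → Prop} (atom : ∀ R v, motive (.atom R v))
    (binary : ∀ z φ ψ, motive φ → motive ψ → motive (binary z φ ψ))
    (quant : ∀ z x φ, motive φ → motive (quant z x φ)) (φ : Fml σ) : motive φ := by
  induction φ with
  | atom R v => exact atom R v
  | and φ ψ ihφ ihψ => exact binary false φ ψ ihφ ihψ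
  | or φ ψ ihφ ihψ => exact binary true φ ψ ihφ ihψ
  | ex x φ ih => exact quant true x φ ih
  | all x φ ih => exact quant false x φ ih

theorem freeVars_binary (z : Bool) (φ ψ : Fml σ) :
    (binary z φ ψ).freeVars = φ.freeVars ∪ ψ.freeVars := by cases z <;> rfl

theorem freeVars_quant (z : Bool) (x : ℕ) (φ : Fml σ) :
    (quant z x φ).freeVars = φ.freeVars \ {x} := by cases z <;> rfl

/-- The token of the connective `binary z`. -/
def connective : Bool → Token σ
  | true => .or
  | false => .and

/-- The token of the quantifier `quant z`. -/
def quantifier : Bool → Token σ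
  | true => .ex
  | false => .all

theorem encode_binary (z : Bool) (φ ψ : Fml σ) : (binary z φ ψ).encode =
    .lparen :: (φ.encode ++ connective z :: (ψ.encode ++ [.rparen])) := by cases z <;> rfl

theorem encode_quant (z : Bool) (x : ℕ) (φ : Fml σ) :
    (quant z x φ).encode = quantifier z :: (encodeVar σ x ++ φ.encode) := by cases z <;> rfl

/-- Truth of a formula whose code starts at index `p` of a word, where an existential (universal)
quantifier at index `q` assigns the value `v true q` (`v false q`) to its variable. -/
def EvalAt (A : RelStr σ) (v : Bool → ℕ → A.carrier) : Fml σ → (ℕ → A.carrier) → ℕ → Prop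
  | atom R x, s, _ => (fun i => s (x i)) ∈ A.rel R
  | and φ ψ, s, p => EvalAt A v φ s (p + 1) ∧ EvalAt A v ψ s (p + 1 + φ.encode.length + 1)
  | or φ ψ, s, p => EvalAt A v φ s (p + 1) ∨ EvalAt A v ψ s (p + 1 + φ.encode.length + 1)
  | ex x φ, s, p =>
    EvalAt A v φ (Function.update s x (v true p)) (p + 1 + (encodeVar σ x).length)
  | all x φ, s, p =>
    EvalAt A v φ (Function.update s x (v false p)) (p + 1 + (encodeVar σ x).length)

open Classical in
theorem decide_evalAt_binary {A : RelStr σ} (v : Bool → ℕ → A.carrier) (z : Bool) (φ ψ : Fml σ)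
    (s : ℕ → A.carrier) (p : ℕ) : decide ((binary z φ ψ).EvalAt A v s p) =
      if decide (φ.EvalAt A v s (p + 1)) = z then z
      else decide (ψ.EvalAt A v s (p + 1 + φ.encode.length + 1)) := by
  cases z <;> by_cases h : φ.EvalAt A v s (p + 1) <;> simp [binary, EvalAt, h]

theorem evalAt_quant {A : RelStr σ} (v : Bool → ℕ → A.carrier) (z : Bool) (x : ℕ) (φ : Fml σ)
    (s : ℕ → A.carrier) (p : ℕ) : (quant z x φ).EvalAt A v s p ↔
      φ.EvalAt A v (Function.update s x (v z p)) (p + 1 + (encodeVar σ x).length) := by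
  cases z <;> rfl

end Fml

/-- How the letters of an annotated word are read: as tokens, and as the values `val true g` and
`val false g` that an existential and a universal quantifier assign to their variables. -/
structure Reading {σ : Signature} (A : RelStr σ) (Γ : Type) where
  tok : Γ → Token σ
  val : Bool → Γ → A.carrier

/-- An atom that is being evaluated: the argument to be looked up next, and the values of the
arguments, correct for those looked up before. -/
abbrev AtomState {σ : Signature} (A : RelStr σ) : Type :=
  Σ R : σ.Sym, Fin (σ.arity R) × (Fin (σ.arity R) → A.carrier)

/-- The states of the evaluating automaton, where `C` is the type of atoms in evaluation and `D` the
type of values. -/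
inductive EvalState (C D : Type) : Type
  /-- at the first token of a formula -/
  | eval : EvalState C D
  /-- in the variable of a quantifier -/
  | qvar : EvalState C D
  /-- right after a formula with truth value `b` -/
  | ret (b : Bool) : EvalState C D
  /-- in a right subformula that is irrelevant -/
  | skip (b : Bool) : EvalState C D
  /-- on the way to the left, in search of the quantifier that binds an argument -/
  | look (c : C) : EvalState C D
  /-- at a letter of the variable of a quantifier, to be compared with the argument -/
  | cmp (c : C) (d : D) : EvalState C D
  /-- on the way to the argument, with the letter that was read -/
  | fwd (c : C) (d : D) (t : Option Bool) : EvalState C D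
  /-- on the way back to the quantifier; `none` after a mismatch -/
  | bwd (c : C) (o : Option D) : EvalState C D
  /-- back to the symbol of a quantifier for another variable -/
  | toQ (c : C) : EvalState C D
  /-- the value `d` of the argument is found -/
  | clear (c : C) (d : D) : EvalState C D
  deriving Fintype

instance EvalState.finite (C D : Type) [Finite C] [Finite D] : Finite (EvalState C D) := by
  have := Fintype.ofFinite C
  have := Fintype.ofFinite D
  infer_instance

namespace Reading

variable {σ : Signature} {A : RelStr σ} {Γ : Type}

/-- The instruction with next state `q`, head move `m` and counter operations `x`, `y`, `z`. -/
def ins {Q : Type} (q : Q) (m x y z : Move) : Option (Q × Move × (Fin 3 → Move)) :=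
  some (q, m, ![x, y, z])

open Classical in
/-- What to do when the value `d` of an argument is found. -/
noncomputable def found (c : AtomState A) (d : A.carrier) :
    Option (EvalState (AtomState A) A.carrier × Move × (Fin 3 → Move)) :=
  if h : (c.2.1 : ℕ) + 1 < σ.arity c.1 then
    ins (.look ⟨c.1, ⟨c.2.1 + 1, h⟩, Function.update c.2.2 c.2.1 d⟩) .stay .stay .stay .stay
  else
    ins (.ret (decide (Function.update c.2.2 c.2.1 d ∈ A.rel c.1))) .right .stay .stay .stay

/-- The transition function. The first counter holds a number of unmatched parentheses. During the
evaluation of an atom, the sum of the second and the third one is the distance from the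
argument. -/
noncomputable def trans (T : Reading A Γ) (q : EvalState (AtomState A) A.carrier) (s : InSym Γ)
    (z : Fin 3 → Bool) : Option (EvalState (AtomState A) A.carrier × Move × (Fin 3 → Move)) :=
  match q with
  | .eval => match s with
    | .leftEnd => ins .eval .right .stay .stay .stay
    | .rightEnd => none
    | .sym g => match T.tok g with
      | .lparen => ins .eval .right .stay .stay .stay
      | .ex | .all => ins .qvar .right .stay .stay .stay
      | .rel R => ins (.look ⟨R, ⟨0, σ.arity_pos R⟩, fun _ => Classical.arbitrary A.carrier⟩)
          .stay .stay .stay .stay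
      | _ => none
  | .qvar => match s with
    | .sym g => match T.tok g with
      | .comma => ins .eval .right .stay .stay .stay
      | _ => ins .qvar .right .stay .stay .stay
    | _ => none
  | .ret b => match s with
    | .sym g => match T.tok g with
      | .rparen => ins (.ret b) .right .stay .stay .stay
      | .and => ins (if b then .eval else .skip b) .right .stay .stay .stay
      | .or => ins (if b then .skip b else .eval) .right .stay .stay .stay
      | _ => none
    | _ => none
  | .skip b => match s with
    | .sym g => match T.tok g with
      | .lparen => ins (.skip b) .right .right .stay .stay
      | .rparen => ins (if z 0 then .ret b else .skip b) .right .left .stay .stay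
      | _ => ins (.skip b) .right .stay .stay .stay
    | _ => none
  | .look c => match s with
    | .sym g => match T.tok g with
      | .and | .or => ins (.look c) .left .right .right .stay
      | .lparen => ins (.look c) .left .left .right .stay
      | .ex => if z 0 then ins (.cmp c (T.val true g)) .right .stay .stay .stay
          else ins (.look c) .left .stay .right .stay
      | .all => if z 0 then ins (.cmp c (T.val false g)) .right .stay .stay .stay
          else ins (.look c) .left .stay .right .stay
      | _ => ins (.look c) .left .stay .right .stay
    | _ => none
  | .cmp c d => match s with
    | .sym g => match T.tok g with
      | .bit b => ins (.fwd c d (some b)) .stay .stay .stay .stay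
      | .comma => ins (.fwd c d none) .stay .stay .stay .stay
      | _ => none
    | _ => none
  | .fwd c d t =>
    if z 1 then match s with
      | .sym g => match T.tok g, t with
        | .bit b, some b' => ins (.bwd c (if b = b' then some d else none)) .stay .stay .stay .stay
        | .comma, none => ins (.clear c d) .stay .stay .stay .stay
        | _, _ => ins (.bwd c none) .stay .stay .stay .stay
      | _ => none
    else ins (.fwd c d t) .right .stay .left .right
  | .bwd c o =>
    if z 2 then match o with
      | some d => ins (.cmp c d) .right .stay .stay .stay
      | none => ins (.toQ c) .stay .stay .stay .stay
    else ins (.bwd c o) .left .stay .right .left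
  | .toQ c => match s with
    | .sym g => match T.tok g with
      | .ex | .all => ins (.look c) .left .stay .right .stay
      | _ => ins (.toQ c) .left .stay .stay .stay
    | _ => none
  | .clear c d => if z 2 then found c d else ins (.clear c d) .stay .stay .stay .left

/-- The automaton that evaluates an annotated formula from left to right. It looks up the value of a
variable by searching to the left for the quantifier that binds it. -/
noncomputable def evalAutomaton (T : Reading A Γ) : CounterAutomaton Γ where
  Q := EvalState (AtomState A) A.carrier
  m := 3
  start := .eval
  δ := T.trans

variable (T : Reading A Γ) (w : List Γ)

/-- The token `t` is written at index `p`. The input head reads it in cell `p + 1`. -/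
def TokAt (p : ℕ) (t : Token σ) : Prop := ∃ g, w[p]? = some g ∧ T.tok g = t

/-- The tokens `l` are written from index `p` on. -/
def Seg : ℕ → List (Token σ) → Prop
  | _, [] => True
  | p, t :: l => T.TokAt w p t ∧ Seg (p + 1) l

/-- The configuration with state `q`, input head in cell `p` and counters `a`, `b`, `c`. -/
def cfg (q : EvalState (AtomState A) A.carrier) (p a b c : ℕ) : T.evalAutomaton.Cfg :=
  ⟨q, p, ![a, b, c]⟩

/-- The automaton gets from one configuration to another one with all counters at most `|w| + 1`
after every step. -/
def Run : T.evalAutomaton.Cfg → T.evalAutomaton.Cfg → Prop :=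
  ReflTransGen (T.evalAutomaton.BStep w)

variable {T w}

theorem TokAt.lt {p : ℕ} {t : Token σ} (h : T.TokAt w p t) : p < w.length := by
  obtain ⟨g, hg, -⟩ := h
  exact (List.getElem?_eq_some_iff.1 hg).1

theorem seg_append {p : ℕ} {l m : List (Token σ)} :
    T.Seg w p (l ++ m) ↔ T.Seg w p l ∧ T.Seg w (p + l.length) m := by
  induction l generalizing p with
  | nil => simp [Seg]
  | cons t l ih =>
    rw [List.cons_append, Seg, Seg, ih, and_assoc, List.length_cons, Nat.add_assoc p 1,
      Nat.add_comm 1]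

theorem seg_of_prefix_drop {l : List (Token σ)} : ∀ {p : ℕ}, l <+: (w.map T.tok).drop p →
    T.Seg w p l := by
  induction l with
  | nil => exact fun _ => trivial
  | cons t l ih =>
    intro p h
    have hp : p < (w.map T.tok).length := by
      by_contra hp
      simp [List.drop_eq_nil_of_le (not_lt.1 hp)] at h
    rw [List.drop_eq_getElem_cons hp, List.cons_prefix_cons] at h
    simp only [List.length_map] at hp
    exact ⟨⟨w[p], List.getElem?_eq_getElem hp, by simpa using h.1.symm⟩, ih h.2⟩

theorem readInput_succ {p : ℕ} {g : Γ} (h : w[p]? = some g) : readInput w (p + 1) = .sym g := by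
  simp only [readInput, h]

theorem run_one {q q' : EvalState (AtomState A) A.carrier} {p p' a a' b b' c c' : ℕ}
    (m x y z : Move)
    (h : T.trans q (readInput w p) ![decide (a = 0), decide (b = 0), decide (c = 0)] =
      ins q' m x y z)
    (hp : m.input w.length p = p' := by simp only [Move.input] <;> omega)
    (ha : x.work a = a' := by simp only [Move.work] <;> omega)
    (hb : y.work b = b' := by simp only [Move.work] <;> omega)
    (hc : z.work c = c' := by simp only [Move.work] <;> omega)
    (hle : a' ≤ w.length + 1 ∧ b' ≤ w.length + 1 ∧ c' ≤ w.length + 1 := by omega) :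
    T.Run w (T.cfg q p a b c) (T.cfg q' p' a' b' c') := by
  have hz : (fun j => decide ((T.cfg q p a b c).ctr j = 0)) =
      ![decide (a = 0), decide (b = 0), decide (c = 0)] := by
    funext j
    change Fin 3 at j
    fin_cases j <;> rfl
  have hi : T.evalAutomaton.instr w (T.cfg q p a b c) = some (q', m, ![x, y, z]) := by
    rw [CounterAutomaton.instr, hz]
    exact h
  subst hp ha hb hc
  refine .single ⟨?_, ?_⟩
  · refine Option.map_eq_some_iff.2 ⟨_, hi, ?_⟩
    simp only [CounterAutomaton.exec, cfg]
    congr 1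
    funext j
    change Fin 3 at j
    fin_cases j <;> rfl
  · intro j
    change Fin 3 at j
    fin_cases j
    exacts [hle.1, hle.2.1, hle.2.2]

theorem Run.trans {c d e : T.evalAutomaton.Cfg} (h : T.Run w c d) (h' : T.Run w d e) :
    T.Run w c e := ReflTransGen.trans h h'

end Reading

/-! ### Searching for the quantifier that binds a variable -/

variable {σ : Signature} {A : RelStr σ} {Γ : Type}

/-- Tokens that change the nesting depth. -/
def IsParen : Token σ → Prop
  | .lparen | .rparen => True
  | _ => False

/-- Tokens that are ignored in the search for quantifiers. -/
def IsNeutral : Token σ → Prop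
  | .rparen | .comma | .bit _ | .rel _ => True
  | _ => False

/-- The letter of a variable as the automaton remembers it: a bit, or `none` for the comma. -/
def letter : Option Bool → Token σ
  | some b => .bit b
  | none => .comma

theorem not_isParen_letter (t : Option Bool) : ¬ IsParen (letter (σ := σ) t) := by
  cases t <;> exact id

theorem isNeutral_letter (t : Option Bool) : IsNeutral (letter (σ := σ) t) := by
  cases t <;> trivial

theorem exists_letter_of_mem_encodeVar {x : ℕ} {t : Token σ} (h : t ∈ encodeVar σ x) :
    ∃ u, letter u = t := by
  rcases List.mem_append.1 h with h | h
  · obtain ⟨b, -, rfl⟩ := List.mem_map.1 h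
    exact ⟨some b, rfl⟩
  · exact ⟨none, (List.mem_singleton.1 h).symm⟩

theorem eq_rel_or_letter_of_mem_encode_atom {R : σ.Sym} {v : Fin (σ.arity R) → ℕ} {t : Token σ}
    (h : t ∈ (Fml.atom R v).encode) : t = .rel R ∨ ∃ u, letter u = t := by
  refine (List.mem_cons.1 h).imp_right fun h => ?_
  obtain ⟨x, -, hx⟩ := List.mem_flatMap.1 h
  exact exists_letter_of_mem_encodeVar hx

/-- If `a` parentheses are open before the token `t`, then `b` are open after it. -/
inductive Skip : Token σ → ℕ → ℕ → Prop
  | other {t} (ht : ¬ IsParen t) (a : ℕ) : Skip t a a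
  | lparen (a : ℕ) : Skip .lparen a (a + 1)
  | rparen (a : ℕ) : Skip .rparen (a + 1) a

/-- If `a` parentheses are open before the tokens `l`, then `b` are open after them. -/
inductive Skips : List (Token σ) → ℕ → ℕ → Prop
  | nil (a : ℕ) : Skips [] a a
  | cons {t l a b c} (ht : Skip t a b) (h : Skips l b c) : Skips (t :: l) a c

theorem Skips.append {l m : List (Token σ)} {a b c : ℕ} (h : Skips l a b) (h' : Skips m b c) :
    Skips (l ++ m) a c := by
  induction h with
  | nil => exact h'
  | cons ht _ ih => exact .cons ht (ih h')

theorem skips_of_not_isParen {l : List (Token σ)} (h : ∀ t ∈ l, ¬ IsParen t) (a : ℕ) :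
    Skips l a a := by
  induction l with
  | nil => exact .nil a
  | cons t l ih => exact .cons (.other (h t (by simp)) a) (ih fun u hu => h u (by simp [hu]))

theorem skips_encodeVar (x a : ℕ) : Skips (encodeVar σ x) a a :=
  skips_of_not_isParen (fun _ ht => by
    obtain ⟨u, rfl⟩ := exists_letter_of_mem_encodeVar ht
    exact not_isParen_letter u) a

theorem skips_encode (φ : Fml σ) (a : ℕ) : Skips φ.encode a a := by
  induction φ using Fml.binary_quant_induction generalizing a with
  | atom R v =>
    refine skips_of_not_isParen (fun t ht => ?_) a
    rcases eq_rel_or_letter_of_mem_encode_atom ht with rfl | ⟨u, rfl⟩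
    exacts [id, not_isParen_letter u]
  | binary z φ ψ ihφ ihψ =>
    rw [Fml.encode_binary]
    exact .cons (.lparen a) ((ihφ _).append (.cons (.other (by cases z <;> exact id) _)
      ((ihψ _).append (.cons (.rparen a) (.nil a)))))
  | quant z x φ ih =>
    rw [Fml.encode_quant]
    exact .cons (.other (by cases z <;> exact id) a) ((skips_encodeVar x a).append (ih a))

/-- The search for a quantifier, from right to left, passes over the token `t`, and the number of
unmatched left operands to be passed over changes from `a` to `b`. Quantifiers are passed over only
inside such operands. -/
inductive Pass : Token σ → ℕ → ℕ → Prop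
  | neutral {t} (ht : IsNeutral t) (a : ℕ) : Pass t a a
  | lparen (a : ℕ) : Pass .lparen a (a - 1)
  | connective (z : Bool) (a : ℕ) : Pass (Fml.connective z) a (a + 1)
  | quantifier (z : Bool) (a : ℕ) : Pass (Fml.quantifier z) (a + 1) (a + 1)

/-- The search passes over the tokens `l`, from right to left. -/
inductive Passes : List (Token σ) → ℕ → ℕ → Prop
  | nil (a : ℕ) : Passes [] a a
  | cons {t l a b c} (ht : Pass t b c) (h : Passes l a b) : Passes (t :: l) a c

theorem Passes.append {l m : List (Token σ)} {a b c : ℕ} (h : Passes l b c) (h' : Passes m a b) :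
    Passes (l ++ m) a c := by
  induction h with
  | nil => exact h'
  | cons ht _ ih => exact .cons ht (ih h')

theorem Pass.le {t : Token σ} {a b : ℕ} (h : Pass t a b) : b ≤ a + 1 := by
  cases h <;> omega

theorem Passes.le {l : List (Token σ)} {a b : ℕ} (h : Passes l a b) : b ≤ a + l.length := by
  induction h with
  | nil => exact Nat.le_add_right _ _
  | cons ht _ ih => exact ht.le.trans (Nat.succ_le_succ ih)

theorem passes_of_isNeutral {l : List (Token σ)} (h : ∀ t ∈ l, IsNeutral t) (a : ℕ) :
    Passes l a a := by
  induction l with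
  | nil => exact .nil a
  | cons t l ih => exact .cons (.neutral (h t (by simp)) a) (ih fun u hu => h u (by simp [hu]))

theorem passes_encodeVar (x a : ℕ) : Passes (encodeVar σ x) a a :=
  passes_of_isNeutral (fun _ ht => by
    obtain ⟨u, rfl⟩ := exists_letter_of_mem_encodeVar ht
    exact isNeutral_letter u) a

theorem passes_encode (φ : Fml σ) (a : ℕ) : Passes φ.encode (a + 1) (a + 1) := by
  induction φ using Fml.binary_quant_induction generalizing a with
  | atom R v =>
    refine passes_of_isNeutral (fun t ht => ?_) _
    rcases eq_rel_or_letter_of_mem_encode_atom ht with rfl | ⟨u, rfl⟩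
    exacts [trivial, isNeutral_letter u]
  | binary z φ ψ ihφ ihψ =>
    rw [Fml.encode_binary]
    exact .cons (.lparen (a + 2)) ((ihφ (a + 1)).append (.cons (.connective z (a + 1))
      ((ihψ a).append (.cons (.neutral (t := .rparen) trivial _) (.nil (a + 1))))))
  | quant z x φ ih =>
    rw [Fml.encode_quant]
    exact .cons (.quantifier z a) ((passes_encodeVar x _).append (ih a))

/-- In a right operand, the search passes over the left operand. -/
theorem passes_left_operand (z : Bool) (φ : Fml σ) :
    Passes (.lparen :: (φ.encode ++ [Fml.connective z])) 0 0 :=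
  .cons (.lparen 1) ((passes_encode φ 0).append (.cons (.connective z 0) (.nil 0)))

namespace Reading

variable {T : Reading A Γ} {w : List Γ}

theorem run_skip_one (b : Bool) {t : Token σ} {a a' p : ℕ} (ht : Skip t a a')
    (h : T.TokAt w p t) (ha : a < w.length + 1) :
    T.Run w (T.cfg (.skip b) (p + 1) a 0 0) (T.cfg (.skip b) (p + 2) a' 0 0) := by
  have hp := h.lt
  obtain ⟨g, hg, hgt⟩ := h
  cases ht with
  | other ht =>
    refine run_one .right .stay .stay .stay ?_
    cases t <;> simp_all [trans, IsParen, readInput_succ hg]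
  | lparen => exact run_one .right .right .stay .stay (by simp [trans, readInput_succ hg, hgt])
  | rparen => exact run_one .right .left .stay .stay (by simp [trans, readInput_succ hg, hgt])

theorem run_skip (b : Bool) {l : List (Token σ)} {a a' : ℕ} (hl : Skips l a a') :
    ∀ {p : ℕ}, T.Seg w p l → a + l.length ≤ w.length + 1 →
    T.Run w (T.cfg (.skip b) (p + 1) a 0 0) (T.cfg (.skip b) (p + l.length + 1) a' 0 0) := by
  induction hl with
  | nil => exact fun _ _ => .refl
  | @cons t l a a' c ht _ ih =>
    intro p h ha
    have hle : a' ≤ a + 1 := by cases ht <;> omega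
    rw [List.length_cons] at ha
    rw [List.length_cons, Nat.add_comm l.length, ← Nat.add_assoc p]
    exact (run_skip_one b ht h.1 (by omega)).trans (ih h.2 (by omega))

theorem run_look_one (c : AtomState A) {t : Token σ} {a a' p k : ℕ} (ht : Pass t a a')
    (h : T.TokAt w p t) (ha : a ≤ k) (hk : k ≤ w.length) :
    T.Run w (T.cfg (.look c) (p + 1) a k 0) (T.cfg (.look c) p a' (k + 1) 0) := by
  obtain ⟨g, hg, hgt⟩ := h
  cases ht with
  | neutral ht =>
    refine run_one .left .stay .right .stay ?_
    cases t <;> simp_all [trans, IsNeutral, readInput_succ hg]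
  | lparen => exact run_one .left .left .right .stay (by simp [trans, readInput_succ hg, hgt])
  | connective z =>
    refine run_one .left .right .right .stay ?_
    cases z <;> simp_all [trans, readInput_succ hg, Fml.connective]
  | quantifier z =>
    refine run_one .left .stay .right .stay ?_
    cases z <;> simp_all [trans, readInput_succ hg, Fml.quantifier]

theorem run_look (c : AtomState A) {l : List (Token σ)} {a a' : ℕ} (hl : Passes l a a') :
    ∀ {p k : ℕ}, T.Seg w p l → a ≤ k → k + l.length ≤ w.length + 1 →
    T.Run w (T.cfg (.look c) (p + l.length) a k 0) (T.cfg (.look c) p a' (k + l.length) 0) := by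
  induction hl with
  | nil => exact fun _ _ _ => .refl
  | @cons t l a b b' ht hl ih =>
    intro p k h ha hk
    have hb := hl.le
    rw [List.length_cons] at hk ⊢
    refine Run.trans ?_ (run_look_one (k := k + l.length) c ht h.1 (by omega) (by omega))
    rw [← Nat.add_assoc, Nat.add_right_comm]
    exact ih h.2 ha (by omega)

theorem run_fwd {c : AtomState A} {d : A.carrier} {t : Option Bool} {k : ℕ}
    (hk : k ≤ w.length + 1) (b : ℕ) : ∀ {p e : ℕ}, e + b = k → p + b ≤ w.length + 1 →
    T.Run w (T.cfg (.fwd c d t) p 0 b e) (T.cfg (.fwd c d t) (p + b) 0 0 k) := by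
  induction b with
  | zero => rintro p e rfl _; exact .refl
  | succ b ih =>
    intro p e he hp
    rw [Nat.add_comm b, ← Nat.add_assoc]
    exact (run_one .right .stay .left .right (by simp [trans])).trans
      (ih (e := e + 1) (by omega) (by omega))

theorem run_bwd {c : AtomState A} {o : Option A.carrier} {p k : ℕ} (hk : k ≤ w.length + 1)
    (e : ℕ) : ∀ {b : ℕ}, b + e = k →
    T.Run w (T.cfg (.bwd c o) (p + e) 0 b e) (T.cfg (.bwd c o) p 0 k 0) := by
  induction e with
  | zero => rintro b rfl; exact .refl
  | succ e ih =>
    intro b he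
    exact (run_one .left .stay .right .left (by simp [trans])).trans (ih (b := b + 1) (by omega))

theorem run_clear {c : AtomState A} {d : A.carrier} {p : ℕ} (e : ℕ) (he : e ≤ w.length + 1) :
    T.Run w (T.cfg (.clear c d) p 0 0 e) (T.cfg (.clear c d) p 0 0 0) := by
  induction e with
  | zero => exact .refl
  | succ e ih =>
    exact (run_one .stay .stay .stay .left (by simp [trans])).trans (ih (by omega))

theorem run_toQ {c : AtomState A} {k : ℕ} (hk : k ≤ w.length + 1) {l : List (Token σ)}
    (hl : ∀ t ∈ l, ∃ u, letter u = t) : ∀ {p : ℕ}, T.Seg w p l →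
    T.Run w (T.cfg (.toQ c) (p + l.length) 0 k 0) (T.cfg (.toQ c) p 0 k 0) := by
  induction l with
  | nil => exact fun _ => .refl
  | cons t l ih =>
    rintro p ⟨⟨g, hg, ht⟩, h⟩
    have h := ih (fun t ht => hl t (List.mem_cons_of_mem _ ht)) h
    rw [Nat.add_assoc, Nat.add_comm 1] at h
    refine h.trans (run_one .left .stay .stay .stay ?_)
    obtain ⟨u, rfl⟩ := hl t (by simp)
    cases u <;> simp_all [trans, letter, readInput_succ hg]

theorem run_cmp_fwd {c : AtomState A} {d : A.carrier} {t u : Option Bool} {p k : ℕ}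
    (ht : T.TokAt w p (letter t)) (hu : T.TokAt w (p + k) (letter u)) :
    T.Run w (T.cfg (.cmp c d) (p + 1) 0 k 0) (T.cfg (.fwd c d t) (p + 1 + k) 0 0 k) := by
  have hk := hu.lt
  obtain ⟨g, hg, ht⟩ := ht
  refine Run.trans (run_one .stay .stay .stay .stay ?_)
    (run_fwd (by omega) k (Nat.zero_add k) (by omega))
  cases t <;> simp [trans, readInput_succ hg, ht, letter]

theorem run_cmp_bit {c : AtomState A} {d : A.carrier} {b : Bool} {p k : ℕ}
    (ht : T.TokAt w p (.bit b)) (hu : T.TokAt w (p + k) (.bit b)) :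
    T.Run w (T.cfg (.cmp c d) (p + 1) 0 k 0) (T.cfg (.cmp c d) (p + 2) 0 k 0) := by
  have hk := hu.lt
  have fwd := run_cmp_fwd (c := c) (d := d) (t := some b) (u := some b) ht hu
  have bwd := run_bwd (T := T) (w := w) (c := c) (o := some d) (p := p + 1) (by omega) k
    (Nat.zero_add k)
  obtain ⟨g, hg, hu⟩ := hu
  refine fwd.trans (Run.trans (run_one .stay .stay .stay .stay ?_)
    (bwd.trans (run_one .right .stay .stay .stay (by simp [trans]))))
  simp [trans, Nat.add_right_comm p 1, readInput_succ hg, hu]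

theorem run_cmp_comma {c : AtomState A} {d : A.carrier} {p k : ℕ}
    (ht : T.TokAt w p .comma) (hu : T.TokAt w (p + k) .comma) :
    T.Run w (T.cfg (.cmp c d) (p + 1) 0 k 0) (T.cfg (.clear c d) (p + 1 + k) 0 0 0) := by
  have hk := hu.lt
  have fwd := run_cmp_fwd (c := c) (d := d) (t := none) (u := none) ht hu
  obtain ⟨g, hg, hu⟩ := hu
  refine fwd.trans (Run.trans (run_one .stay .stay .stay .stay ?_) (run_clear k (by omega)))
  simp [trans, Nat.add_right_comm p 1, readInput_succ hg, hu]

theorem run_cmp_letter_of_ne {c : AtomState A} {d : A.carrier} {t u : Option Bool} (htu : t ≠ u)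
    {p k : ℕ} (ht : T.TokAt w p (letter t)) (hu : T.TokAt w (p + k) (letter u)) :
    T.Run w (T.cfg (.cmp c d) (p + 1) 0 k 0) (T.cfg (.toQ c) (p + 1) 0 k 0) := by
  have hk := hu.lt
  have fwd := run_cmp_fwd (c := c) (d := d) ht hu
  have bwd := run_bwd (T := T) (w := w) (c := c) (o := none) (p := p + 1) (by omega) k
    (Nat.zero_add k)
  obtain ⟨g, hg, hu⟩ := hu
  refine fwd.trans (Run.trans (run_one .stay .stay .stay .stay ?_)
    (bwd.trans (run_one .stay .stay .stay .stay (by simp [trans]))))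
  rw [Nat.add_right_comm, readInput_succ hg]
  cases t <;> cases u <;> simp_all [trans, letter, Ne.symm]

theorem run_cmp_self {c : AtomState A} {d : A.carrier} {k : ℕ} (l : List Bool) : ∀ {p : ℕ},
    T.Seg w p (l.map .bit ++ [.comma]) → T.Seg w (p + k) (l.map .bit ++ [.comma]) →
    T.Run w (T.cfg (.cmp c d) (p + 1) 0 k 0) (T.cfg (.clear c d) (p + l.length + 1 + k) 0 0 0) := by
  induction l with
  | nil => exact fun h h' => run_cmp_comma h.1 h'.1
  | cons b l ih =>
    intro p h h'
    rw [List.length_cons, Nat.add_comm l.length, ← Nat.add_assoc]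
    exact (run_cmp_bit h.1 h'.1).trans (ih h.2 (by rw [Nat.add_right_comm]; exact h'.2))

theorem exists_run_cmp_of_ne {c : AtomState A} {d : A.carrier} {k : ℕ} :
    ∀ {l m : List Bool}, l ≠ m → ∀ {p : ℕ}, T.Seg w p (l.map .bit ++ [.comma]) →
    T.Seg w (p + k) (m.map .bit ++ [.comma]) →
    ∃ j ≤ l.length, T.Run w (T.cfg (.cmp c d) (p + 1) 0 k 0) (T.cfg (.toQ c) (p + j + 1) 0 k 0)
  | [], [], hlm, _, _, _ => absurd rfl hlm
  | [], b :: _, _, _, h, h' =>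
    ⟨0, le_rfl, run_cmp_letter_of_ne (t := none) (u := some b) (by simp) h.1 h'.1⟩
  | b :: _, [], _, _, h, h' =>
    ⟨0, Nat.zero_le _, run_cmp_letter_of_ne (t := some b) (u := none) (by simp) h.1 h'.1⟩
  | b :: l, b' :: m, hlm, p, h, h' => by
    by_cases hb : b = b'
    · subst hb
      obtain ⟨j, hj, hr⟩ := exists_run_cmp_of_ne (fun hlm' => hlm (by rw [hlm'])) h.2
        (by rw [Nat.add_right_comm]; exact h'.2)
      rw [Nat.add_right_comm p 1 j] at hr
      exact ⟨j + 1, Nat.succ_le_succ hj, (run_cmp_bit h.1 h'.1).trans hr⟩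
    · exact ⟨0, Nat.zero_le _,
        run_cmp_letter_of_ne (t := some b) (u := some b') (by simpa) h.1 h'.1⟩

theorem run_cmp_of_ne {c : AtomState A} {d : A.carrier} {k p x y : ℕ} (hxy : x ≠ y)
    (h : T.Seg w p (encodeVar σ x)) (h' : T.Seg w (p + k) (encodeVar σ y)) :
    T.Run w (T.cfg (.cmp c d) (p + 1) 0 k 0) (T.cfg (.toQ c) p 0 k 0) := by
  have hbits : x.bits ≠ y.bits := fun hb =>
    hxy (encodeVar_cancel (σ := σ) (r := []) (s := []) (by rw [encodeVar, hb, encodeVar])).1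
  obtain ⟨j, hj, hr⟩ := exists_run_cmp_of_ne (c := c) (d := d) hbits h h'
  have hk := (seg_append.1 h').2.1.lt
  have hlen : ((encodeVar σ x).take (j + 1)).length = j + 1 := by simpa [encodeVar] using hj
  rw [← List.take_append_drop (j + 1) (encodeVar σ x), seg_append] at h
  have htoQ := run_toQ (c := c) (k := k) (by omega) (fun t ht =>
    exists_letter_of_mem_encodeVar (List.mem_of_mem_take ht)) h.1
  rw [hlen] at htoQ
  exact hr.trans htoQ

variable (T w) in
/-- The search for the variable `x`, starting before index `p`, finds the value `d`. -/
def Binds (p x : ℕ) (d : A.carrier) : Prop :=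
  ∀ (k : ℕ) (c : AtomState A), T.Seg w (p + k) (encodeVar σ x) →
    T.Run w (T.cfg (.look c) p 0 k 0) (T.cfg (.clear c d) (p + k + (encodeVar σ x).length) 0 0 0)

theorem Seg.encodeVar_length_le {p x : ℕ} (h : T.Seg w p (encodeVar σ x)) :
    p + (encodeVar σ x).length ≤ w.length := by
  have := (seg_append.1 h).2.1.lt
  simpa [encodeVar, ← Nat.add_assoc] using this

theorem Binds.of_passes {p x : ℕ} {d : A.carrier} (h : T.Binds w p x d) {l : List (Token σ)}
    (hl : T.Seg w p l) (hp : Passes l 0 0) : T.Binds w (p + l.length) x d := by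
  intro k c hs
  have := hs.encodeVar_length_le
  have look := run_look c hp (k := k) hl (Nat.zero_le _) (by omega)
  rw [Nat.add_right_comm p, Nat.add_assoc p k] at hs ⊢
  exact look.trans (h (k + l.length) c hs)

/-- A quantifier that assigns the value `d` to its variable, existential if `z = true` and universal
if `z = false`, is written at index `p`. -/
def QuantAt (T : Reading A Γ) (w : List Γ) (p : ℕ) (z : Bool) (d : A.carrier) : Prop :=
  ∃ g, w[p]? = some g ∧ T.tok g = Fml.quantifier z ∧ T.val z g = d

namespace QuantAt

variable {p y : ℕ} {z : Bool} {d : A.carrier}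

theorem run_cmp (hq : QuantAt T w p z d) (hy : T.Seg w (p + 1) (encodeVar σ y)) {k : ℕ}
    (hk : k + (encodeVar σ y).length ≤ w.length + 1) (c : AtomState A) :
    T.Run w (T.cfg (.look c) (p + 1 + (encodeVar σ y).length) 0 k 0)
      (T.cfg (.cmp c d) (p + 2) 0 (k + (encodeVar σ y).length) 0) := by
  have hp := hy.encodeVar_length_le
  obtain ⟨g, hg, ht, rfl⟩ := hq
  refine (run_look c (passes_encodeVar y 0) hy (Nat.zero_le _) hk).trans
    (run_one .right .stay .stay .stay ?_)
  cases z <;> simp [trans, readInput_succ hg, ht, Fml.quantifier]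

theorem binds_self (hq : QuantAt T w p z d) (hy : T.Seg w (p + 1) (encodeVar σ y)) :
    T.Binds w (p + 1 + (encodeVar σ y).length) y d := by
  intro k c hs
  have := hs.encodeVar_length_le
  rw [Nat.add_right_comm (p + 1), Nat.add_assoc (p + 1) k] at hs
  have cmp := run_cmp_self (c := c) (d := d) y.bits hy hs
  refine (hq.run_cmp hy (by omega) c).trans ?_
  convert cmp using 2
  simp only [encodeVar, List.length_append, List.length_map, List.length_singleton]
  omega

theorem binds_of_ne (hq : QuantAt T w p z d) (hy : T.Seg w (p + 1) (encodeVar σ y)) {x : ℕ}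
    (hxy : x ≠ y) {e : A.carrier} (h : T.Binds w p x e) :
    T.Binds w (p + 1 + (encodeVar σ y).length) x e := by
  intro k c hs
  have := hs.encodeVar_length_le
  rw [Nat.add_right_comm (p + 1), Nat.add_assoc (p + 1) k] at hs ⊢
  have cmp := run_cmp_of_ne (c := c) (d := d) hxy.symm hy hs
  rw [Nat.add_right_comm p 1 (k + _)] at hs ⊢
  have look := h (k + (encodeVar σ y).length + 1) c hs
  refine ((hq.run_cmp hy (by omega) c).trans cmp).trans (Run.trans ?_ look)
  obtain ⟨g, hg, ht, -⟩ := hq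
  refine run_one .left .stay .right .stay ?_
  cases z <;> simp [trans, readInput_succ hg, ht, Fml.quantifier]

theorem binds_update (hq : QuantAt T w p z d) (hy : T.Seg w (p + 1) (encodeVar σ y))
    {s : ℕ → A.carrier} {V : Set ℕ} (h : ∀ x ∈ V \ {y}, T.Binds w p x (s x)) {x : ℕ}
    (hx : x ∈ V) : T.Binds w (p + 1 + (encodeVar σ y).length) x (Function.update s y d x) := by
  by_cases hxy : x = y
  · subst hxy
    rw [Function.update_self]
    exact hq.binds_self hy
  · rw [Function.update_of_ne hxy]
    exact hq.binds_of_ne hy hxy (h x ⟨hx, hxy⟩)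

end QuantAt

end Reading

/-- The code of the first `i` variables of an atom. -/
def encodeArgs {n : ℕ} (v : Fin n → ℕ) (i : ℕ) : List (Token σ) :=
  ((List.ofFn v).take i).flatMap (encodeVar σ)

theorem encodeArgs_succ {n : ℕ} (v : Fin n → ℕ) (i : Fin n) :
    encodeArgs (σ := σ) v (i + 1) = encodeArgs v i ++ encodeVar σ (v i) := by
  rw [encodeArgs, List.take_add_one, List.flatMap_append, encodeArgs]
  simp

theorem encode_atom (R : σ.Sym) (v : Fin (σ.arity R) → ℕ) :
    (Fml.atom R v).encode = .rel R :: encodeArgs v (σ.arity R) := by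
  rw [encodeArgs, List.take_of_length_le (by simp), Fml.encode]

theorem passes_encodeArgs (R : σ.Sym) {n : ℕ} (v : Fin n → ℕ) (i : ℕ) :
    Passes (.rel R :: encodeArgs v i) 0 0 := by
  refine passes_of_isNeutral (fun t ht => ?_) 0
  rcases List.mem_cons.1 ht with rfl | ht
  · trivial
  · obtain ⟨x, -, hx⟩ := List.mem_flatMap.1 ht
    obtain ⟨u, rfl⟩ := exists_letter_of_mem_encodeVar hx
    exact isNeutral_letter u

namespace Reading

variable {T : Reading A Γ} {w : List Γ}

theorem seg_atom {p : ℕ} {R : σ.Sym} {v : Fin (σ.arity R) → ℕ}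
    (h : T.Seg w p (Fml.atom R v).encode) (i : Fin (σ.arity R)) :
    T.Seg w p (.rel R :: encodeArgs v i) ∧
      T.Seg w (p + ((encodeArgs (σ := σ) v i).length + 1)) (encodeVar σ (v i)) := by
  rw [Fml.encode, ← List.take_append_drop (i + 1) (List.ofFn v), List.flatMap_append,
    ← encodeArgs, encodeArgs_succ, ← List.cons_append, seg_append, ← List.cons_append,
    seg_append] at h
  exact h.1

theorem run_look_arg {p : ℕ} {R : σ.Sym} {v : Fin (σ.arity R) → ℕ} {s : ℕ → A.carrier}
    (h : T.Seg w p (Fml.atom R v).encode) (hv : ∀ i, T.Binds w p (v i) (s (v i)))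
    (i : Fin (σ.arity R)) (u : Fin (σ.arity R) → A.carrier) :
    T.Run w (T.cfg (.look ⟨R, i, u⟩) (p + ((encodeArgs (σ := σ) v i).length + 1)) 0 0 0)
      (T.cfg (.clear ⟨R, i, u⟩ (s (v i)))
        (p + ((encodeArgs (σ := σ) v (i + 1)).length + 1)) 0 0 0) := by
  obtain ⟨hargs, hvar⟩ := seg_atom h i
  have hend : p + ((encodeArgs (σ := σ) v (i + 1)).length + 1) =
      p + ((encodeArgs (σ := σ) v i).length + 1) + (encodeVar σ (v i)).length := by
    rw [encodeArgs_succ, List.length_append]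
    omega
  rw [hend]
  exact (hv i).of_passes hargs (passes_encodeArgs R v i) 0 ⟨R, i, u⟩ hvar

theorem exists_run_look {p : ℕ} {R : σ.Sym} {v : Fin (σ.arity R) → ℕ} {s : ℕ → A.carrier}
    (h : T.Seg w p (Fml.atom R v).encode) (hv : ∀ i, T.Binds w p (v i) (s (v i)))
    (u₀ : Fin (σ.arity R) → A.carrier) (i : ℕ) (hi : i < σ.arity R) :
    ∃ u, (∀ j : Fin (σ.arity R), (j : ℕ) < i → u j = s (v j)) ∧
      T.Run w (T.cfg (.look ⟨R, ⟨0, σ.arity_pos R⟩, u₀⟩) (p + 1) 0 0 0)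
        (T.cfg (.look ⟨R, ⟨i, hi⟩, u⟩) (p + ((encodeArgs (σ := σ) v i).length + 1)) 0 0 0) := by
  induction i with
  | zero => exact ⟨u₀, fun _ hj => absurd hj (Nat.not_lt_zero _), .refl⟩
  | succ i ih =>
    have hi' := Nat.lt_of_succ_lt hi
    have hend := (seg_atom h ⟨i + 1, hi⟩).2.encodeVar_length_le
    obtain ⟨u, hu, hr⟩ := ih hi'
    refine ⟨Function.update u ⟨i, hi'⟩ (s (v ⟨i, hi'⟩)), fun j hj => ?_,
      (hr.trans (run_look_arg h hv ⟨i, hi'⟩ u)).trans (run_one .stay .stay .stay .stay ?_)⟩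
    · rcases (Nat.lt_succ_iff.1 hj).lt_or_eq with hj | rfl
      · rw [Function.update_of_ne (Fin.ne_of_lt hj), hu j hj]
      · rw [Function.update_self]
    · simp [trans, found, hi]

open Classical in
theorem run_atom {p : ℕ} {R : σ.Sym} {v : Fin (σ.arity R) → ℕ} {s : ℕ → A.carrier}
    (h : T.Seg w p (Fml.atom R v).encode) (hv : ∀ i, T.Binds w p (v i) (s (v i))) :
    T.Run w (T.cfg .eval (p + 1) 0 0 0) (T.cfg (.ret (decide ((fun i => s (v i)) ∈ A.rel R)))
      (p + (Fml.atom R v).encode.length + 1) 0 0 0) := by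
  obtain ⟨n, hn⟩ : ∃ n, n + 1 = σ.arity R := ⟨_, Nat.sub_add_cancel (σ.arity_pos R)⟩
  have hnlt : n < σ.arity R := Nat.lt_of_succ_le hn.le
  obtain ⟨u, hu, hlook⟩ := exists_run_look h hv (fun _ => Classical.arbitrary _) n hnlt
  have harg := run_look_arg h hv ⟨n, hnlt⟩ u
  have hs : Function.update u ⟨n, hnlt⟩ (s (v ⟨n, hnlt⟩)) = fun i => s (v i) := by
    funext j
    by_cases hj : j = ⟨n, hnlt⟩
    · rw [hj, Function.update_self]
    · rw [Function.update_of_ne hj, hu j (lt_of_le_of_ne (by omega) (Fin.val_ne_of_ne hj))]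
  have hend : p + ((encodeArgs (σ := σ) v (n + 1)).length + 1) + 1 =
      p + (Fml.atom R v).encode.length + 1 := by
    rw [encode_atom, List.length_cons, congrArg (encodeArgs v) hn]
  have hle := (seg_atom h ⟨n, hnlt⟩).2.encodeVar_length_le
  have hlen := congrArg List.length (encodeArgs_succ (σ := σ) v ⟨n, hnlt⟩)
  rw [List.length_append] at hlen
  dsimp only at hle hlen
  have := h.1.lt
  obtain ⟨g, hg, ht⟩ := h.1
  rw [← hs, ← hend]
  refine Run.trans (run_one .stay .stay .stay .stay (by simp [trans, readInput_succ hg, ht]))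
    (hlook.trans (harg.trans (run_one .right .stay .stay .stay ?_)))
  simp [trans, found, hn]

theorem run_qvar_bits (l : List Bool) : ∀ {p : ℕ}, T.Seg w p (l.map .bit ++ [.comma]) →
    T.Run w (T.cfg .qvar (p + 1) 0 0 0) (T.cfg .eval (p + l.length + 2) 0 0 0) := by
  induction l with
  | nil =>
    intro p h
    have hp := h.1.lt
    obtain ⟨⟨g, hg, ht⟩, -⟩ := h
    change T.Run w _ (T.cfg .eval (p + 2) 0 0 0)
    exact run_one .right .stay .stay .stay (by simp [trans, readInput_succ hg, ht])
  | cons b l ih =>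
    intro p h
    have hp := h.1.lt
    obtain ⟨⟨g, hg, ht⟩, h⟩ := h
    rw [List.length_cons, Nat.add_comm l.length, ← Nat.add_assoc]
    exact Run.trans (run_one .right .stay .stay .stay (by simp [trans, readInput_succ hg, ht]))
      (ih h)

theorem run_qvar {x p : ℕ} (h : T.Seg w p (encodeVar σ x)) :
    T.Run w (T.cfg .qvar (p + 1) 0 0 0) (T.cfg .eval (p + (encodeVar σ x).length + 1) 0 0 0) := by
  simpa [encodeVar, Nat.add_assoc] using run_qvar_bits x.bits h

theorem run_lparen {p : ℕ} (h : T.TokAt w p .lparen) :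
    T.Run w (T.cfg .eval (p + 1) 0 0 0) (T.cfg .eval (p + 2) 0 0 0) := by
  have hp := h.lt
  obtain ⟨g, hg, ht⟩ := h
  exact run_one .right .stay .stay .stay (by simp [trans, readInput_succ hg, ht])

theorem run_ret_connective {p : ℕ} {z : Bool} (h : T.TokAt w p (Fml.connective z)) (b : Bool) :
    T.Run w (T.cfg (.ret b) (p + 1) 0 0 0)
      (T.cfg (if b = z then .skip z else .eval) (p + 2) 0 0 0) := by
  have hp := h.lt
  obtain ⟨g, hg, ht⟩ := h
  refine run_one .right .stay .stay .stay ?_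
  cases b <;> cases z <;> simp_all [trans, readInput_succ hg, Fml.connective]

theorem run_rparen {p : ℕ} (h : T.TokAt w p .rparen) {q : EvalState (AtomState A) A.carrier}
    {b : Bool} (hq : q = .ret b ∨ q = .skip b) :
    T.Run w (T.cfg q (p + 1) 0 0 0) (T.cfg (.ret b) (p + 2) 0 0 0) := by
  have hp := h.lt
  obtain ⟨g, hg, ht⟩ := h
  rcases hq with rfl | rfl
  · exact run_one .right .stay .stay .stay (by simp [trans, readInput_succ hg, ht])
  · exact run_one .right .left .stay .stay (by simp [trans, readInput_succ hg, ht])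

theorem run_eval_binary {z : Bool} {φ ψ : Fml σ} {p : ℕ} {b₁ b₂ : Bool}
    (h : T.Seg w p (Fml.binary z φ ψ).encode)
    (hφ : T.Run w (T.cfg .eval (p + 2) 0 0 0) (T.cfg (.ret b₁) (p + 1 + φ.encode.length + 1) 0 0 0))
    (hψ : T.Run w (T.cfg .eval (p + 1 + φ.encode.length + 2) 0 0 0)
      (T.cfg (.ret b₂) (p + 1 + φ.encode.length + 1 + ψ.encode.length + 1) 0 0 0)) :
    T.Run w (T.cfg .eval (p + 1) 0 0 0) (T.cfg (.ret (if b₁ = z then z else b₂))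
      (p + (Fml.binary z φ ψ).encode.length + 1) 0 0 0) := by
  have hlen : p + (Fml.binary z φ ψ).encode.length + 1 =
      p + 1 + φ.encode.length + 1 + ψ.encode.length + 2 := by
    simp only [Fml.encode_binary, List.length_cons, List.length_append, List.length_nil]
    omega
  rw [Fml.encode_binary, Seg, seg_append, Seg, seg_append] at h
  obtain ⟨hl, -, hc, hs, hr, -⟩ := h
  have := hr.lt
  rw [hlen]
  refine ((run_lparen hl).trans hφ).trans ((run_ret_connective hc b₁).trans ?_)
  split_ifs with hz
  · exact (run_skip z (skips_encode ψ 0) hs (by omega)).trans (run_rparen hr (.inr rfl))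
  · exact hψ.trans (run_rparen hr (.inl rfl))

theorem run_eval_quant {z : Bool} {x : ℕ} {φ : Fml σ} {p : ℕ} {b : Bool}
    (h : T.Seg w p (Fml.quant z x φ).encode)
    (hφ : T.Run w (T.cfg .eval (p + 1 + (encodeVar σ x).length + 1) 0 0 0)
      (T.cfg (.ret b) (p + 1 + (encodeVar σ x).length + φ.encode.length + 1) 0 0 0)) :
    T.Run w (T.cfg .eval (p + 1) 0 0 0)
      (T.cfg (.ret b) (p + (Fml.quant z x φ).encode.length + 1) 0 0 0) := by
  have hlen : p + (Fml.quant z x φ).encode.length =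
      p + 1 + (encodeVar σ x).length + φ.encode.length := by
    simp only [Fml.encode_quant, List.length_cons, List.length_append]
    omega
  rw [hlen]
  rw [Fml.encode_quant, Seg, seg_append] at h
  have hp := h.1.lt
  obtain ⟨⟨g, hg, ht⟩, hx, -⟩ := h
  refine Run.trans (run_one .right .stay .stay .stay ?_) ((run_qvar hx).trans hφ)
  cases z <;> simp [trans, readInput_succ hg, ht, Fml.quantifier]

open Classical in
theorem run_eval {v : Bool → ℕ → A.carrier} (hval : ∀ z p g, w[p]? = some g → T.val z g = v z p)
    (φ : Fml σ) : ∀ {p : ℕ} {s : ℕ → A.carrier}, T.Seg w p φ.encode →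
    (∀ x ∈ φ.freeVars, T.Binds w p x (s x)) →
    T.Run w (T.cfg .eval (p + 1) 0 0 0)
      (T.cfg (.ret (decide (φ.EvalAt A v s p))) (p + φ.encode.length + 1) 0 0 0) := by
  induction φ using Fml.binary_quant_induction with
  | atom R v => exact fun h hv => run_atom h fun i => hv _ ⟨i, rfl⟩
  | binary z φ ψ ihφ ihψ =>
    intro p s h hv
    rw [Fml.freeVars_binary] at hv
    have h' := h
    rw [Fml.encode_binary, Seg, seg_append] at h'
    obtain ⟨hl, hφ, hc, hψ⟩ := h'
    rw [seg_append] at hψ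
    rw [Fml.decide_evalAt_binary]
    refine run_eval_binary h (ihφ hφ fun x hx => ?_) (ihψ hψ.1 fun x hx => ?_)
    · exact (hv x (.inl hx)).of_passes (l := [.lparen]) ⟨hl, trivial⟩ (.cons (.lparen 0) (.nil 0))
    · have := (hv x (.inr hx)).of_passes (l := .lparen :: (φ.encode ++ [Fml.connective z]))
        ⟨hl, seg_append.2 ⟨hφ, hc, trivial⟩⟩ (passes_left_operand z φ)
      convert this using 1
      simp only [List.length_cons, List.length_append, List.length_nil]
      omega
  | quant z x φ ih =>
    intro p s h hv
    rw [Fml.freeVars_quant] at hv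
    have h' := h
    rw [Fml.encode_quant, Seg, seg_append] at h'
    obtain ⟨⟨g, hg, ht⟩, hx, hφ⟩ := h'
    have hq : QuantAt T w p z (v z p) := ⟨g, hg, ht, hval z p g hg⟩
    simp only [Fml.evalAt_quant]
    exact run_eval_quant h (ih hφ fun y hy => hq.binds_update hx hv hy)

open Classical in
theorem haltsIn_evalAutomaton {v : Bool → ℕ → A.carrier}
    (hval : ∀ z p g, w[p]? = some g → T.val z g = v z p) {φ : Sentence σ}
    (hw : w.map T.tok = φ.1.encode) (s : ℕ → A.carrier) :
    T.evalAutomaton.HaltsIn w (.ret (decide (φ.1.EvalAt A v s 0))) := by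
  have hseg : T.Seg w 0 φ.1.encode := seg_of_prefix_drop (by rw [hw, List.drop_zero])
  have hl : φ.1.encode.length = w.length := by rw [← hw, List.length_map]
  have hinit : T.evalAutomaton.initCfg = T.cfg .eval 0 0 0 0 := by
    simp only [CounterAutomaton.initCfg, cfg]
    congr 1
    funext j
    change Fin 3 at j
    fin_cases j <;> rfl
  refine ⟨_, hinit ▸ Run.trans (run_one .right .stay .stay .stay rfl)
    (run_eval hval φ.1 (s := s) hseg fun x hx => absurd hx (by simp [φ.2])), ?_, rfl⟩
  refine Option.map_eq_none_iff.2 ?_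
  rw [hl, CounterAutomaton.instr, cfg, readInput_of_ge (Nat.zero_add _).ge]
  rfl

end Reading

/-! ### Duality -/

/-- The structure with the complements of the relations of `A`. -/
def RelStr.compl (A : RelStr σ) : RelStr σ where
  carrier := A.carrier
  rel := fun R => (A.rel R)ᶜ
  rel_nonempty := fun R => Set.nonempty_compl.2 (A.rel_proper R)
  rel_proper := fun R h => (A.rel_nonempty R).ne_empty (Set.compl_univ_iff.1 h)

/-- The token with the dual role. -/
def Token.dual : Token σ → Token σ
  | .and => .or
  | .or => .and
  | .ex => .all
  | .all => .ex
  | t => t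

namespace Fml

/-- The dual formula, with `∧`, `∨` and `∃`, `∀` exchanged. -/
def dual : Fml σ → Fml σ
  | atom R v => atom R v
  | and φ ψ => or φ.dual ψ.dual
  | or φ ψ => and φ.dual ψ.dual
  | ex x φ => all x φ.dual
  | all x φ => ex x φ.dual

theorem freeVars_dual (φ : Fml σ) : φ.dual.freeVars = φ.freeVars := by
  induction φ with
  | atom R v => rfl
  | and φ ψ ihφ ihψ => simp only [dual, freeVars, ihφ, ihψ]
  | or φ ψ ihφ ihψ => simp only [dual, freeVars, ihφ, ihψ]
  | ex x φ ih => simp only [dual, freeVars, ih]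
  | all x φ ih => simp only [dual, freeVars, ih]

theorem map_dual_encodeVar (x : ℕ) : (encodeVar σ x).map Token.dual = encodeVar σ x := by
  simp [encodeVar, Token.dual, Function.comp_def]

theorem encode_dual (φ : Fml σ) : φ.dual.encode = φ.encode.map Token.dual := by
  induction φ with
  | atom R v => simp [dual, encode, Token.dual, List.map_flatMap, map_dual_encodeVar]
  | and φ ψ ihφ ihψ => simp [dual, encode, Token.dual, ihφ, ihψ]
  | or φ ψ ihφ ihψ => simp [dual, encode, Token.dual, ihφ, ihψ]
  | ex x φ ih => simp [dual, encode, Token.dual, ih, map_dual_encodeVar]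
  | all x φ ih => simp [dual, encode, Token.dual, ih, map_dual_encodeVar]

theorem sat_compl_dual (A : RelStr σ) (φ : Fml σ) :
    ∀ s : ℕ → A.carrier, φ.dual.Sat A.compl s ↔ ¬ φ.Sat A s := by
  induction φ with
  | atom R v => exact fun s => Iff.rfl
  | and φ ψ ihφ ihψ => exact fun s => (or_congr (ihφ s) (ihψ s)).trans not_and_or.symm
  | or φ ψ ihφ ihψ => exact fun s => (and_congr (ihφ s) (ihψ s)).trans not_or.symm
  | ex x φ ih => exact fun s => (forall_congr' fun a => ih _).trans not_exists.symm
  | all x φ ih => exact fun s => (exists_congr fun a => ih _).trans not_forall.symm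

theorem evalAt_compl_dual (A : RelStr σ) (v : Bool → ℕ → A.carrier) (φ : Fml σ) :
    ∀ (s : ℕ → A.carrier) (p : ℕ),
      φ.dual.EvalAt A.compl v s p ↔ ¬ φ.EvalAt A (fun z => v !z) s p := by
  have hlen (φ : Fml σ) : φ.dual.encode.length = φ.encode.length := by
    rw [encode_dual, List.length_map]
  induction φ with
  | atom R v => exact fun s p => Iff.rfl
  | and φ ψ ihφ ihψ =>
    intro s p
    simp only [dual, EvalAt, hlen]
    exact (or_congr (ihφ s _) (ihψ s _)).trans not_and_or.symm
  | or φ ψ ihφ ihψ =>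
    intro s p
    simp only [dual, EvalAt, hlen]
    exact (and_congr (ihφ s _) (ihψ s _)).trans not_or.symm
  | ex x _ ih => exact fun s p => ih _ _
  | all x _ ih => exact fun s p => ih _ _

end Fml

variable {B : RelStr σ} {f : A.carrier → Set B.carrier}

theorem IsSMuHom.compl (hf : IsSMuHom A B f) : IsSMuHom B.compl A.compl (mvInverse f) where
  value_nonempty := hf.surjective
  surjective := hf.value_nonempty
  map_rel := fun R b hb a hab ha => hb (hf.map_rel R a ha b hab)

theorem IsEShop.compl (hf : IsEShop A B f) : IsAShop B.compl A.compl (mvInverse f) :=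
  ⟨hf.1.compl, hf.2⟩

/-! ### Surjective multi-homomorphisms preserve truth -/

theorem mem_update {s : ℕ → A.carrier} {t : ℕ → B.carrier}
    {V : Set ℕ} {y : ℕ} (h : ∀ x ∈ V \ {y}, t x ∈ f (s x)) {a : A.carrier} {b : B.carrier}
    (hab : b ∈ f a) : ∀ x ∈ V, Function.update t y b x ∈ f (Function.update s y a x) := by
  intro x hx
  by_cases hxy : x = y
  · subst hxy
    rwa [Function.update_self, Function.update_self]
  · rw [Function.update_of_ne hxy, Function.update_of_ne hxy]
    exact h x ⟨hx, hxy⟩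

namespace Fml

theorem sat_of_isSMuHom (hf : IsSMuHom A B f) (φ : Fml σ) :
    ∀ {s : ℕ → A.carrier} {t : ℕ → B.carrier}, (∀ x ∈ φ.freeVars, t x ∈ f (s x)) →
      φ.Sat A s → φ.Sat B t := by
  induction φ with
  | atom R v => exact fun hst h => hf.map_rel R _ h _ fun i => hst (v i) ⟨i, rfl⟩
  | and φ ψ ihφ ihψ =>
    exact fun hst => And.imp (ihφ fun x hx => hst x (.inl hx)) (ihψ fun x hx => hst x (.inr hx))
  | or φ ψ ihφ ihψ =>
    exact fun hst => Or.imp (ihφ fun x hx => hst x (.inl hx)) (ihψ fun x hx => hst x (.inr hx))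
  | ex x φ ih =>
    rintro s t hst ⟨d, h⟩
    obtain ⟨e, he⟩ := hf.value_nonempty d
    exact ⟨e, ih (mem_update hst he) h⟩
  | all x φ ih =>
    intro s t hst h e
    obtain ⟨d, he⟩ := hf.surjective e
    exact ih (mem_update hst he) (h d)

theorem sat_of_evalAt (hf : IsSMuHom A B f) {v : Bool → ℕ → A.carrier}
    (hv : ∀ q, f (v false q) = Set.univ) (φ : Fml σ) :
    ∀ {s : ℕ → A.carrier} {t : ℕ → B.carrier} {p : ℕ}, (∀ x ∈ φ.freeVars, t x ∈ f (s x)) →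
      φ.EvalAt A v s p → φ.Sat B t := by
  induction φ with
  | atom R v => exact fun hst h => hf.map_rel R _ h _ fun i => hst (v i) ⟨i, rfl⟩
  | and φ ψ ihφ ihψ =>
    exact fun hst => And.imp (ihφ fun x hx => hst x (.inl hx)) (ihψ fun x hx => hst x (.inr hx))
  | or φ ψ ihφ ihψ =>
    exact fun hst => Or.imp (ihφ fun x hx => hst x (.inl hx)) (ihψ fun x hx => hst x (.inr hx))
  | ex x φ ih =>
    intro s t p hst h
    obtain ⟨e, he⟩ := hf.value_nonempty (v true p)
    exact ⟨e, ih (mem_update hst he) h⟩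
  | all x φ ih => exact fun {_ _ p} hst h e => ih (mem_update hst (hv p ▸ Set.mem_univ e)) h

theorem evalAt_of_sat (hf : IsSMuHom A B f) {v : Bool → ℕ → B.carrier}
    (hv : ∀ q, mvInverse f (v true q) = Set.univ) (φ : Fml σ) {s : ℕ → A.carrier}
    {t : ℕ → B.carrier} {p : ℕ} (hst : ∀ x ∈ φ.freeVars, t x ∈ f (s x)) (h : φ.Sat A s) :
    φ.EvalAt B v t p := by
  by_contra he
  refine (sat_compl_dual A φ s).1 (sat_of_evalAt (p := p) (v := fun z => v !z) hf.compl hv φ.dual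
    (s := t) (by rwa [freeVars_dual]) ((evalAt_compl_dual B _ φ t p).2 ?_)) h
  simpa only [Bool.not_not] using he

theorem evalAt_congr {v v' : Bool → ℕ → A.carrier} (φ : Fml σ) : ∀ {s : ℕ → A.carrier} {p : ℕ},
    (∀ z q, p ≤ q → q < p + φ.encode.length → v z q = v' z q) →
    (φ.EvalAt A v s p ↔ φ.EvalAt A v' s p) := by
  induction φ using binary_quant_induction with
  | atom R v => exact fun _ => Iff.rfl
  | binary z φ ψ ihφ ihψ =>
    intro s p h
    simp only [encode_binary, List.length_cons, List.length_append, List.length_nil] at h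
    have hφ := ihφ (s := s) (p := p + 1) fun z q h1 h2 => h z q (by omega) (by omega)
    have hψ := ihψ (s := s) (p := p + 1 + φ.encode.length + 1)
      fun z q h1 h2 => h z q (by omega) (by omega)
    cases z
    exacts [and_congr hφ hψ, or_congr hφ hψ]
  | quant z x φ ih =>
    intro s p h
    simp only [encode_quant, List.length_cons, List.length_append] at h
    rw [evalAt_quant, evalAt_quant, h z p le_rfl (by omega)]
    exact ih fun z q h1 h2 => h z q (by omega) (by omega)

theorem exists_evalAt_of_sat (a : A.carrier) (φ : Fml σ) : ∀ {s : ℕ → A.carrier} (p : ℕ),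
    φ.Sat A s → ∃ g : ℕ → A.carrier, φ.EvalAt A (fun z q => bif z then g q else a) s p := by
  induction φ with
  | atom R v => exact fun p h => ⟨fun _ => a, h⟩
  | and φ ψ ihφ ihψ =>
    intro s p h
    obtain ⟨g, hg⟩ := ihφ (p + 1) h.1
    obtain ⟨g', hg'⟩ := ihψ (p + 1 + φ.encode.length + 1) h.2
    refine ⟨fun q => if q < p + 1 + φ.encode.length then g q else g' q,
      (evalAt_congr φ fun z q _ hq => ?_).2 hg, (evalAt_congr ψ fun z q hq _ => ?_).2 hg'⟩
    · simp only [if_pos hq]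
    · simp only [if_neg (show ¬ q < p + 1 + φ.encode.length by omega)]
  | or φ ψ ihφ ihψ =>
    rintro s p (h | h)
    · exact (ihφ (p + 1) h).imp fun g => .inl
    · exact (ihψ (p + 1 + φ.encode.length + 1) h).imp fun g => .inr
  | ex x φ ih =>
    rintro s p ⟨d, h⟩
    obtain ⟨g, hg⟩ := ih (p + 1 + (encodeVar σ x).length) h
    refine ⟨Function.update g p d, ?_⟩
    simp only [EvalAt, cond_true, Function.update_self]
    refine (evalAt_congr φ fun z q hq _ => ?_).2 hg
    rw [Function.update_of_ne (by omega)]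
  | all x φ ih => exact fun p h => ih _ (h a)

end Fml

theorem isSMuHom_singleton (A : RelStr σ) : IsSMuHom A A fun a => {a} where
  value_nonempty := Set.singleton_nonempty
  surjective := fun b => ⟨b, rfl⟩
  map_rel := fun _ a ha b hb => (funext hb : b = a) ▸ ha

namespace Sentence

theorem notMem_freeVars (φ : Sentence σ) (x : ℕ) : x ∉ φ.1.freeVars := by
  rw [φ.2]
  exact Set.notMem_empty x

theorem models_iff_sat (φ : Sentence σ) (s : ℕ → A.carrier) : Models A φ ↔ φ.1.Sat A s :=
  ⟨fun h => h s, fun h _ => φ.1.sat_of_isSMuHom (isSMuHom_singleton A)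
    (fun x hx => absurd hx (φ.notMem_freeVars x)) h⟩

/-- The dual sentence. -/
def dual (φ : Sentence σ) : Sentence σ := ⟨φ.1.dual, φ.1.freeVars_dual.trans φ.2⟩

theorem models_compl_dual (φ : Sentence σ) : Models A.compl φ.dual ↔ ¬ Models A φ := by
  let s : ℕ → A.carrier := fun _ => Classical.arbitrary _
  rw [φ.models_iff_sat s, φ.dual.models_iff_sat (A := A.compl) s]
  exact φ.1.sat_compl_dual A s

theorem models_of_evalAt (hf : IsSMuHom A B f) {v : Bool → ℕ → A.carrier}
    (hv : ∀ q, f (v false q) = Set.univ) {φ : Sentence σ} {s : ℕ → A.carrier} {p : ℕ}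
    (h : φ.1.EvalAt A v s p) : Models B φ :=
  fun _ => φ.1.sat_of_evalAt hf hv (fun x hx => absurd hx (φ.notMem_freeVars x)) h

theorem evalAt_of_models (hf : IsSMuHom A B f) {v : Bool → ℕ → B.carrier}
    (hv : ∀ q, mvInverse f (v true q) = Set.univ) {φ : Sentence σ} (h : Models A φ)
    (t : ℕ → B.carrier) (p : ℕ) : φ.1.EvalAt B v t p :=
  φ.1.evalAt_of_sat hf hv (s := fun _ => Classical.arbitrary _)
    (fun x hx => absurd hx (φ.notMem_freeVars x)) (h _)

end Sentence

theorem IsSMuHom.isTemplate (hf : IsSMuHom A B f) : IsTemplate A B :=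
  fun φ h _ => φ.1.sat_of_isSMuHom hf (s := fun _ => Classical.arbitrary _)
    (fun x hx => absurd hx (φ.notMem_freeVars x)) (h _)

/-! ### Upper bounds -/

open Classical in
theorem IsAShop.inNP (hf : IsAShop A B f) (P : PromiseProblem)
    (h : P.Alphabet → Token σ) (F : P.Inst → Sentence σ)
    (hF : ∀ i, (P.encode i).map h = (F i).1.encode) (hyes : ∀ i ∈ P.yes, Models A (F i))
    (hno : ∀ i ∈ P.no, ¬ Models B (F i)) : P.InNP := by
  obtain ⟨hf, a, ha⟩ := hf
  let T : Reading A (P.Alphabet × A.carrier) := ⟨h ∘ Prod.fst, fun z g => bif z then g.2 else a⟩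
  have htok {i} {y : List (P.Alphabet × A.carrier)} (hy : y.map Prod.fst = P.encode i) :
      y.map T.tok = (F i).1.encode := by
    rw [← hF i, ← hy, List.map_map]
  let s : ℕ → A.carrier := fun _ => a
  refine CounterAutomaton.inNP_of_haltsIn P T.evalAutomaton {.ret true} (fun i y hy => ?_)
    fun i hi => ?_
  · let v (z : Bool) (p : ℕ) : A.carrier := bif z then (y[p]?.map Prod.snd).getD a else a
    have hval : ∀ z p g, y[p]? = some g → T.val z g = v z p := by simp +contextual [T, v]
    refine ⟨_, Reading.haltsIn_evalAutomaton hval (htok hy) s, fun hi hq => hno i hi ?_⟩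
    exact Sentence.models_of_evalAt hf (fun _ => ha) (of_decide_eq_true (EvalState.ret.inj hq))
  · obtain ⟨g, hg⟩ := (F i).1.exists_evalAt_of_sat a 0 (hyes i hi s)
    let y := (P.encode i).mapIdx fun p t => (t, g p)
    have hy : y.map Prod.fst = P.encode i :=
      List.ext_getElem? fun p => by simp [y, Function.comp_def]
    have hval : ∀ z p d, y[p]? = some d → T.val z d = bif z then g p else a := by
      rintro z p d hd
      obtain ⟨t, -, rfl⟩ := by simpa [y] using hd
      rfl
    exact ⟨y, hy, _, congrArg EvalState.ret (decide_eq_true hg),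
      Reading.haltsIn_evalAutomaton hval (htok hy) s⟩

theorem IsAShop.PMC_inNP (hf : IsAShop A B f)
    (hAB : IsTemplate A B) : (PMC A B hAB).InNP :=
  hf.inNP (PMC A B hAB) id id (fun _ => List.map_id _) (fun _ h => h) fun _ h => h

theorem IsEShop.PMC_inCoNP (hf : IsEShop A B f)
    (hAB : IsTemplate A B) : (PMC A B hAB).InCoNP :=
  hf.compl.inNP (PMC A B hAB).swap Token.dual Sentence.dual (fun φ => φ.1.encode_dual.symm)
    (fun φ h => φ.models_compl_dual.2 h) fun φ h => not_not.2 h ∘ φ.models_compl_dual.1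

open Classical in
theorem IsEAShop.MC_inL {g : A.carrier → Set A.carrier} (hg : IsEAShop A A g) : (MC A).InL := by
  obtain ⟨⟨hg, a, ha⟩, -, b, hb⟩ := hg
  let T : Reading A (Token σ) := ⟨id, fun z _ => bif z then b else a⟩
  let s : ℕ → A.carrier := fun _ => a
  refine CounterAutomaton.inL_of_haltsIn (MC A) T.evalAutomaton {.ret true} fun φ =>
    ⟨_, Reading.haltsIn_evalAutomaton (v := fun z _ => bif z then b else a) (fun _ _ _ _ => rfl)
      (List.map_id _) s, fun h => ?_, fun h hq => h ?_⟩
  · exact congrArg EvalState.ret (decide_eq_true (Sentence.evalAt_of_models hg (fun _ => hb) h s 0))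
  · exact Sentence.models_of_evalAt hg (fun _ => ha) (of_decide_eq_true (EvalState.ret.inj hq))

theorem IsRelaxation.inL {C D : RelStr σ} (h : IsRelaxation A B C D) (hAB : IsTemplate A B)
    (hCD : IsTemplate C D) (hL : (PMC C D hCD).InL) : (PMC A B hAB).InL := by
  obtain ⟨M, c, hdet, hhalt, hspace, hyes, hno⟩ := hL
  exact ⟨M, c, hdet, hhalt, hspace, fun φ hφ => hyes φ (h.1 φ hφ),
    fun φ hφ => hno φ fun hD => hφ (h.2 φ hD)⟩

/-! ### The interpolating structure -/

/-- The structure on `Bool` with the images of the relations of `A`, where `a` is mapped to both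
elements and any other element to `true`. It lies between `A` and `B` if `f` is an EA-shop. -/
def interpolant (hf : IsSMuHom A B f) {a : A.carrier} (ha : f a = Set.univ) : RelStr σ where
  carrier := Bool
  rel := fun R => {c | ∃ r ∈ A.rel R, ∀ i, c i = false → r i = a}
  rel_nonempty := fun R => (A.rel_nonempty R).elim fun r hr => ⟨fun _ => true, r, hr, nofun⟩
  rel_proper := fun R h => by
    obtain ⟨r, hr, hra⟩ := h.ge (Set.mem_univ fun _ => false)
    refine B.rel_proper R (Set.eq_univ_of_forall fun b => hf.map_rel R r hr b fun i => ?_)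
    rw [hra i rfl, ha]
    exact Set.mem_univ _

section Interpolant

variable (hf : IsSMuHom A B f) {a : A.carrier} (ha : f a = Set.univ)

theorem isSMuHom_interpolant :
    IsSMuHom A (interpolant hf ha) fun x => {c : Bool | c = false → x = a} where
  value_nonempty := fun _ => ⟨true, nofun⟩
  surjective := fun _ => ⟨a, fun _ => rfl⟩
  map_rel := fun _ r hr _ hc => ⟨r, hr, hc⟩

theorem interpolant_isSMuHom {b : B.carrier} (hb : mvInverse f b = Set.univ) :
    IsSMuHom (interpolant hf ha) B fun c : Bool => {y | c = true → y = b} where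
  value_nonempty := fun _ => ⟨b, fun _ => rfl⟩
  surjective := fun _ => ⟨false, nofun⟩
  map_rel := by
    rintro R c ⟨r, hr, hra⟩ y hy
    refine hf.map_rel R r hr y fun i => ?_
    cases hc : c i with
    | false => exact hra i hc ▸ ha ▸ Set.mem_univ _
    | true => exact hy i hc ▸ hb.ge (Set.mem_univ (r i))

theorem interpolant_isEAShop :
    IsEAShop (interpolant hf ha) (interpolant hf ha)
      fun c : Bool => {d : Bool | c = true → d = true} := by
  have h : IsSMuHom (interpolant hf ha) (interpolant hf ha)
      fun c : Bool => {d : Bool | c = true → d = true} :=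
    { value_nonempty := fun _ => ⟨true, fun _ => rfl⟩
      surjective := fun _ => ⟨false, nofun⟩
      map_rel := by
        rintro R c ⟨r, hr, hra⟩ d hd
        refine ⟨r, hr, fun i hi => hra i (Bool.eq_false_of_not_eq_true fun hc => ?_)⟩
        exact Bool.false_ne_true (hi.symm.trans (hd i hc)) }
  exact ⟨⟨h, false, Set.eq_univ_of_forall fun _ => nofun⟩,
    h, true, Set.eq_univ_of_forall fun _ _ => rfl⟩

end Interpolant

theorem IsEAShop.exists_isRelaxation (hf : IsEAShop A B f) :
    ∃ C : RelStr σ, (∃ g, IsEAShop C C g) ∧ IsRelaxation A B C C := by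
  obtain ⟨⟨hf, a, ha⟩, -, b, hb⟩ := hf
  exact ⟨interpolant hf ha, ⟨_, interpolant_isEAShop hf ha⟩,
    (isSMuHom_interpolant hf ha).isTemplate, (interpolant_isSMuHom hf ha hb).isTemplate⟩

end PromiseMC

theorem mainTheorem4 (σ : PromiseMC.Signature) (A B : PromiseMC.RelStr σ)
    (hAB : PromiseMC.IsTemplate A B) :
    ((∃ f, PromiseMC.IsAShop A B f) → (PromiseMC.PMC A B hAB).InNP) ∧
    ((∃ f, PromiseMC.IsEShop A B f) → (PromiseMC.PMC A B hAB).InCoNP) ∧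
    ((∃ f, PromiseMC.IsEAShop A B f) →
      (PromiseMC.PMC A B hAB).InL ∧
      ∃ C : PromiseMC.RelStr σ, (∃ g, PromiseMC.IsEAShop C C g) ∧
        PromiseMC.IsRelaxation A B C C ∧ (PromiseMC.MC C).InL) := by
  refine ⟨fun ⟨f, hf⟩ => hf.PMC_inNP hAB, fun ⟨f, hf⟩ => hf.PMC_inCoNP hAB, fun ⟨f, hf⟩ => ?_⟩
  obtain ⟨C, ⟨g, hg⟩, hC⟩ := hf.exists_isRelaxation
  exact ⟨hC.inL hAB _ hg.MC_inL, C, ⟨g, hg⟩, hC, hg.MC_inL⟩
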